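/- Setting. Let $n\ge 1$ and let $\mathcal M$ be a finite message set. All logarithms are natural. For $\rho>0$, $\mathbf G_\rho$ denotes a vector of $n$ independent $N(0,\rho)$ variables; distinct Gaussian vectors are independent. A code $\mathcal C=(\mathbf X,\hat m)$ consists of a (possibly random) encoder $\mathbf X:\mathcal M\to\mathbb R^n$ and a measurable decoder $\hat m:\mathbb R^n\to\mathcal M\cup\{!\}$; it is deterministic if its encoder is a fixed function and its decoder never outputs $!$. Put $$r_{\mathcal C}=\tfrac1n\log|\mathcal M|,\qquad \omega_{\mathcal C}=\max_{m}\sum_{i=1}^n\tfrac1n\mathbb E[X_i(m)^2],\qquad \varepsilon_{\mathcal C}(\rho)=\tfrac1{|\mathcal M|}\sum_{m}\Pr\big(\hat m(\mathbf X(m)+\mathbf G_\rho)\ne m\big),$$ $$\alpha^*_{\mathcal C}(\rho_{\rm Dec},\rho_{\rm Adv})=\sup_{\mathbf Z,\;a\ne b}\Pr\big(\hat m(\mathbf X(a)+\mathbf G_{\rho_{\rm Dec}}+\mathbf Z(\mathbf X(a)+\mathbf G_{\rho_{\rm Adv}},a))=b\big),$$ the supremum being over measurable $\mathbf Z:\mathbb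 R^n\times\mathcal M\to\mathbb R^n$ and distinct $a,b\in\mathcal M$. Let $\mathcal K\subset[0,1)$ be finite, $\tilde{\mathcal K}=\mathcal K\cup\{1\}$, $\ell=\lfloor n/|\tilde{\mathcal K}|\rfloor$, $\gamma\in(\tfrac12,1)$ and $r>0$. A function $\mathbf f:\mathcal M\to\tilde{\mathcal K}^n$ is an $(r,\mathcal K,\gamma)$-overlay code if $\frac1n\log|\mathcal M|\ge r$; $|\{i:f_i(m)=k\}|=\ell$ for all $m\in\mathcal M$, $k\in\mathcal K$; and for all distinct $m,m'\in\mathcal M$ there is $k\in\mathcal K$ with $|\{i:f_i(m)=k,\ f_i(m')=k\}|\le\gamma\ell$ and $|\{i:f_i(m)=k,\ f_i(m')=j\}|=0$ for all $j\in\mathcal K$ with $j<k$. Code modification. Let $\mathcal H=(\mathbf x,\hat m)$ be a deterministic code, $\rho_\Delta,\rho_{\rm Dec},\rho_{\rm Adv}\in(0,\infty)$, $\delta\in(0,1)$, and let $\mathbf f$ be an $(r_{\mathcal H},\mathcal K,\gamma)$-overlay code (so $r_{\mathcal H}>0$). Choose $t_i(m)\sim N(0,(1-f_i(m)^2)\rho_\Delta)$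 independently for all $m\in\mathcal M$, $1\le i\le n$. The modified code $\mathcal J=(\mathbf X',\hat m')$ has encoder $\mathbf X'(m)=\mathbf x(m)+\mathbf t(m)+\mathbf f(m)\cdot\mathbf G_{\rho_\Delta}$ (coordinatewise product), and decoder $\hat m'(\mathbf y)=\hat m(\mathbf y)$ if, with $\hat m=\hat m(\mathbf y)$, $$\sum_{i:\,f_i(\hat m)=k}\frac{[y_i-t_i(\hat m)-x_i(\hat m)]^2}{k^2\rho_\Delta+\rho_{\rm Dec}}\le\ell(1+\delta)\quad\text{for all }k\in\mathcal K,$$ and $\hat m'(\mathbf y)=\,!$ otherwise. Theorem. With probability greater than $1-\big(2+\sqrt{2/\pi}\big)e^{-n}$ over the choice of $\mathbf t$, the code $\mathcal J$ satisfies simultaneously $$r_{\mathcal J}=r_{\mathcal H},$$ $$\omega_{\mathcal J}\le\omega_{\mathcal H}+2\sqrt{2\,\omega_{\mathcal H}\,\rho_\Delta(r_{\mathcal H}+1)}+\rho_\Delta\Big(1+8|\tilde{\mathcal K}|\Big[r_{\mathcal H}+1+\tfrac{\log|\mathcal K|}{n}\Big]\Big),$$ $$\varepsilon_{\mathcal J}(\rho_{\rm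 Dec})\le\varepsilon_{\mathcal H}(\rho_{\rm Dec}+\rho_\Delta)+\sqrt{\tfrac n2e^{-nr_{\mathcal H}}}+|\mathcal K|e^{-\frac18\ell\delta^2},$$ $$\alpha^*_{\mathcal J}(\rho_{\rm Dec},\rho_{\rm Adv})\le e^{-\frac18\ell(1-\gamma)\lambda^2}+e^{-\frac18\ell\gamma\lambda^2},$$ where $$\lambda=\max\Big(0,\ \min_{k\in\mathcal K}\Big[1-\frac{(1+\delta)(k^2\rho_\Delta+\rho_{\rm Dec})}{\gamma\tau^\star(k)+(1-\gamma)\tau^\star(d_k)}\Big]\Big),\quad \tau^\star(a)=\frac{a^2\rho_\Delta\rho_{\rm Adv}}{a^2\rho_\Delta+\rho_{\rm Adv}}+\rho_{\rm Dec},\quad d_k=\min\{d\in\tilde{\mathcal K}: d>k\}.$$ -/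

import Mathlib

open MeasureTheory ProbabilityTheory
open scoped ENNReal BigOperators

/-- The law of a vector of `n` independent centred Gaussians, the `i`-th with variance `v i`. -/
noncomputable def gaussianVec {n : ℕ} (v : Fin n → ℝ) : Measure (Fin n → ℝ) :=
  Measure.pi fun i => gaussianReal 0 (v i).toNNReal

instance gaussianVec_isProbabilityMeasure {n : ℕ} (v : Fin n → ℝ) :
    IsProbabilityMeasure (gaussianVec v) := by
  unfold gaussianVec; infer_instance

/-- The law of `n` independent centred Gaussians of common variance `ρ`. -/
noncomputable def gaussianIID (n : ℕ) (ρ : ℝ) : Measure (Fin n → ℝ) :=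
  gaussianVec fun _ => ρ

instance gaussianIID_isProbabilityMeasure (n : ℕ) (ρ : ℝ) :
    IsProbabilityMeasure (gaussianIID n ρ) := by
  unfold gaussianIID; infer_instance

/-- A (stochastic) code of block length `n` with message set `M`. The encoder is given by the law
`encoder m` of the random codeword `X(m)`. The decoder outputs a message or `none`, the symbol
that declares the observation not authentic. -/
structure Code (M : Type*) (n : ℕ) where
  encoder : M → Measure (Fin n → ℝ)
  isProbabilityMeasure_encoder : ∀ m, IsProbabilityMeasure (encoder m)
  decoder : (Fin n → ℝ) → Option M
  measurableSet_decoder : ∀ o : Option M, MeasurableSet {y | decoder y = o}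

namespace Code

variable {M : Type*} [Fintype M] {n : ℕ}

/-- The rate `(1/n) log |M|`. -/
noncomputable def rate (_C : Code M n) : ℝ :=
  1 / (n : ℝ) * Real.log (Fintype.card M)

/-- The power constraint `max_m ∑ i, (1/n) E[X_i(m)^2]`, as an extended nonnegative real, since
the second moments of a stochastic code can be infinite. -/
noncomputable def power (C : Code M n) : ℝ≥0∞ :=
  ⨆ m : M, ∑ i : Fin n, (n : ℝ≥0∞)⁻¹ * ∫⁻ x, ENNReal.ofReal (x i ^ 2) ∂(C.encoder m)

/-- The arithmetic average error probability at noise variance `ρDec`: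
the average over `m` of `Pr (decoder (X(m) + G_Dec) ≠ m)`. -/
noncomputable def errorProb (C : Code M n) (ρDec : ℝ) : ℝ :=
  ∑ m : M, 1 / (Fintype.card M : ℝ) *
    ((C.encoder m).prod (gaussianIID n ρDec)).real
      {p | C.decoder (p.1 + p.2) ≠ some m}

/-- The probability that the decoder outputs `b` when `a` is sent and the adversary, who sees
`V = X(a) + G_Adv` and knows `a`, adds `Z(V, a)`. The sample point is `(X(a), G_Dec, G_Adv)`. -/
noncomputable def targetedProb (C : Code M n) (ρDec ρAdv : ℝ)
    (Z : (Fin n → ℝ) → M → (Fin n → ℝ)) (a b : M) : ℝ :=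
  ((C.encoder a).prod ((gaussianIID n ρDec).prod (gaussianIID n ρAdv))).real
    {p | C.decoder (p.1 + p.2.1 + Z (p.1 + p.2.2) a) = some b}

/-- The maximum probability of targeted false authentication: the supremum over all (measurable)
adversaries `Z` and all pairs of distinct messages `a`, `b`. The set is bounded above by `1`. -/
noncomputable def targetedFalseAuth (C : Code M n) (ρDec ρAdv : ℝ) : ℝ :=
  sSup {p : ℝ | ∃ Z : (Fin n → ℝ) → M → (Fin n → ℝ), (∀ m, Measurable fun v => Z v m) ∧
    ∃ a b : M, b ≠ a ∧ p = C.targetedProb ρDec ρAdv Z a b}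

end Code

/-- A deterministic code, whose decoder always outputs a message. -/
structure DetCode (M : Type*) (n : ℕ) where
  x : M → Fin n → ℝ
  dec : (Fin n → ℝ) → M
  measurableSet_dec : ∀ m, MeasurableSet {y | dec y = m}

/-- A deterministic code seen as a code: the codeword has a point-mass law. -/
noncomputable def DetCode.toCode {M : Type*} {n : ℕ} (H : DetCode M n) : Code M n where
  encoder m := Measure.dirac (H.x m)
  isProbabilityMeasure_encoder _ := inferInstance
  decoder y := some (H.dec y)
  measurableSet_decoder o := by
    cases o with
    | none => simp
    | some m => simpa using H.measurableSet_dec m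

/-- `K ∪ {1}`. -/
noncomputable def tildeK (K : Finset ℝ) : Finset ℝ := insert 1 K

/-- `ℓ = ⌊n / |K ∪ {1}|⌋`. -/
noncomputable def levelSize (n : ℕ) (K : Finset ℝ) : ℕ := n / (tildeK K).card

/-- The coordinates at which `u` takes the value `k`. -/
noncomputable def levelSet {n : ℕ} (u : Fin n → ℝ) (k : ℝ) : Finset (Fin n) :=
  Finset.univ.filter fun i => u i = k

/-- `f` is an `(r, K, γ)`-overlay code. -/
structure IsOverlayCode {M : Type*} [Fintype M] {n : ℕ} (r : ℝ) (K : Finset ℝ) (γ : ℝ)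
    (f : M → Fin n → ℝ) : Prop where
  level_mem : ∀ k ∈ K, 0 ≤ k ∧ k < 1
  rate_pos : 0 < r
  gamma_mem : 1 / 2 < γ ∧ γ < 1
  value_mem : ∀ m i, f m i ∈ tildeK K
  rate_le : r ≤ 1 / (n : ℝ) * Real.log (Fintype.card M)
  card_level : ∀ m, ∀ k ∈ K, (levelSet (f m) k).card = levelSize n K
  separated : ∀ m m' : M, m ≠ m' → ∃ k ∈ K,
    ((levelSet (f m) k ∩ levelSet (f m') k).card : ℝ) ≤ γ * levelSize n K ∧
    ∀ j ∈ K, j < k → (levelSet (f m) k ∩ levelSet (f m') j).card = 0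

section CodeModification

variable {M : Type*} {n : ℕ}

/-- The law of the random choice of `t`: all `t m i` are independent, centred Gaussian with
variance `(1 - f_i(m)^2) ρΔ`. -/
noncomputable def shiftLaw [Fintype M] (f : M → Fin n → ℝ) (ρΔ : ℝ) :
    Measure (M → Fin n → ℝ) :=
  Measure.pi fun m => gaussianVec fun i => (1 - f m i ^ 2) * ρΔ

/-- The detector's test of the observation `y` for the message `m`: for every level `k ∈ K`, the
normalized energy of `y - t(m) - x(m)` on the coordinates of level `k` is at most `ℓ (1 + δ)`. -/
def passesTest (x f t : M → Fin n → ℝ) (K : Finset ℝ) (ρΔ ρDec δ : ℝ)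
    (y : Fin n → ℝ) (m : M) : Prop :=
  ∀ k ∈ K, ∑ i ∈ levelSet (f m) k, (y i - t m i - x m i) ^ 2 / (k ^ 2 * ρΔ + ρDec)
    ≤ levelSize n K * (1 + δ)

open Classical in
/-- The modified decoder. -/
noncomputable def modifiedDecoder (H : DetCode M n) (f t : M → Fin n → ℝ) (K : Finset ℝ)
    (ρΔ ρDec δ : ℝ) (y : Fin n → ℝ) : Option M :=
  if passesTest H.x f t K ρΔ ρDec δ y (H.dec y) then some (H.dec y) else none

theorem measurableSet_passesTest (x f t : M → Fin n → ℝ) (K : Finset ℝ) (ρΔ ρDec δ : ℝ) (m : M) :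
    MeasurableSet {y | passesTest x f t K ρΔ ρDec δ y m} := by
  have h : {y | passesTest x f t K ρΔ ρDec δ y m} = ⋂ k ∈ K,
      {y : Fin n → ℝ | ∑ i ∈ levelSet (f m) k, (y i - t m i - x m i) ^ 2 / (k ^ 2 * ρΔ + ρDec)
        ≤ levelSize n K * (1 + δ)} := by
    ext y; simp [passesTest]
  rw [h]
  refine Finset.measurableSet_biInter _ fun k _ => ?_
  exact measurableSet_le (by fun_prop) measurable_const

theorem measurableSet_modifiedDecoder [Fintype M] (H : DetCode M n) (f t : M → Fin n → ℝ)
    (K : Finset ℝ) (ρΔ ρDec δ : ℝ) (o : Option M) :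
    MeasurableSet {y | modifiedDecoder H f t K ρΔ ρDec δ y = o} := by
  have hs : ∀ m : M, MeasurableSet {y | modifiedDecoder H f t K ρΔ ρDec δ y = some m} := by
    intro m
    have h : {y | modifiedDecoder H f t K ρΔ ρDec δ y = some m} =
        {y | H.dec y = m} ∩ {y | passesTest H.x f t K ρΔ ρDec δ y m} := by
      ext y
      simp only [modifiedDecoder, Set.mem_ofPred_eq, Set.mem_inter_iff]
      split_ifs with hp
      · constructor
        · intro e
          have e' : H.dec y = m := by simpa using e
          exact ⟨e', e' ▸ hp⟩
        · rintro ⟨e, _⟩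
          rw [e]
      · constructor
        · intro e; simp at e
        · rintro ⟨e, hq⟩
          exact absurd (e ▸ hq) hp
    rw [h]
    exact (H.measurableSet_dec m).inter (measurableSet_passesTest _ _ _ _ _ _ _ _)
  cases o with
  | some m => exact hs m
  | none =>
    have h : {y | modifiedDecoder H f t K ρΔ ρDec δ y = none} =
        (⋃ m : M, {y | modifiedDecoder H f t K ρΔ ρDec δ y = some m})ᶜ := by
      ext y
      simp only [Set.mem_ofPred_eq, Set.mem_compl_iff, Set.mem_iUnion]
      rw [Option.eq_none_iff_forall_ne_some]
      simp
    rw [h]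
    exact (MeasurableSet.iUnion hs).compl

/-- The code that the modification yields for a given choice of `t`: the codeword is
`x(m) + t(m) + f(m) · G_Δ` with the coordinatewise product, and the decoder is
`modifiedDecoder`. -/
noncomputable def modifiedCode [Fintype M] (H : DetCode M n) (f : M → Fin n → ℝ) (K : Finset ℝ)
    (ρΔ ρDec δ : ℝ) (t : M → Fin n → ℝ) : Code M n where
  encoder m := (gaussianIID n ρΔ).map fun g => H.x m + t m + f m * g
  isProbabilityMeasure_encoder m :=
    Measure.isProbabilityMeasure_map (by fun_prop)
  decoder := modifiedDecoder H f t K ρΔ ρDec δ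
  measurableSet_decoder := measurableSet_modifiedDecoder H f t K ρΔ ρDec δ

end CodeModification

/-- `τ⋆(a) = a² ρΔ ρAdv / (a² ρΔ + ρAdv) + ρDec`. -/
noncomputable def tauStar (ρΔ ρDec ρAdv a : ℝ) : ℝ :=
  a ^ 2 * ρΔ * ρAdv / (a ^ 2 * ρΔ + ρAdv) + ρDec

/-- `d_k = min {d ∈ K ∪ {1} | d > k}` (a finite set, nonempty for `k < 1`). -/
noncomputable def nextLevel (K : Finset ℝ) (k : ℝ) : ℝ :=
  sInf {d : ℝ | d ∈ tildeK K ∧ k < d}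

/-- `λ = max (0, min_{k ∈ K} (1 - (1+δ)(k² ρΔ + ρDec) / (γ τ⋆(k) + (1-γ) τ⋆(d_k))))`. -/
noncomputable def detectionGap (K : Finset ℝ) (γ ρΔ ρDec ρAdv δ : ℝ) : ℝ :=
  max 0 (⨅ k : K, (1 - (1 + δ) * ((k : ℝ) ^ 2 * ρΔ + ρDec) /
    (γ * tauStar ρΔ ρDec ρAdv k + (1 - γ) * tauStar ρΔ ρDec ρAdv (nextLevel K k))))

/-! The shift `t m` and the artificial noise `f m · G_Δ` have complementary variances, so averaged
over `t` the decoder of `H` sees white noise of variance `ρDec + ρΔ`. For fixed `t` the error of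
message `m` depends only on `t m` and lies in `[0, 1]`. Hoeffding's inequality over the independent
`t m` (`shiftLaw_errorProb_le`) thus keeps the average error close to that of `H`. The other source
of error, rejection of the true message, is a chi-square upper tail on each level
(`passesTest_failure_le`). The power bound is a union bound over the `e^{nr}` messages of two
Gaussian tails: the correlation of `t m` with the codeword, and the energy of `t m`.

False authentication is bounded for every `t`. Given the adversary's observation, a signal
coordinate of variance `v` seen in noise `w` keeps variance `v w / (v + w)`. With the receiver's
noise this becomes `τ⋆(f_i(a))`, and this residual is independent of the attack. To pass as `b`, its
shifted energy on the level-`k` coordinates of `f b` must stay below `ℓ (1 + δ) (k² ρΔ + ρDec)`. For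
the `k` given by the overlay property, at most a fraction `γ` of these coordinates has level `k` in
`f a`, and the others have level at least `d_k`. The mean energy is therefore at least `ℓ (γ τ⋆(k) +
(1 - γ) τ⋆(d_k))`, and no shift improves the exponential lower-tail bound (`gaussianVec_attack_le`,
with the exponent computed in `detection_exponent_le`). -/

/-- Chernoff bound for a sum of functions of the coordinates under a product measure. -/
theorem measure_pi_sum_ge_le {ι : Type*} [Fintype ι] (μ : ι → Measure ℝ)
    [∀ i, IsProbabilityMeasure (μ i)] {h : ι → ℝ → ℝ} (hm : ∀ i, Measurable (h i)) {β : ι → ℝ}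
    (hβ : ∀ i, ∫⁻ y, ENNReal.ofReal (Real.exp (h i y)) ∂μ i ≤ ENNReal.ofReal (Real.exp (β i)))
    (T : ℝ) :
    Measure.pi μ {y | T ≤ ∑ i, h i (y i)} ≤ ENNReal.ofReal (Real.exp (∑ i, β i - T)) := by
  have hX : iIndepFun (fun i (y : ι → ℝ) => ENNReal.ofReal (Real.exp (h i (y i)))) (Measure.pi μ) :=
    iIndepFun_pi (X := fun i y => ENNReal.ofReal (Real.exp (h i y)))
      fun i => (by have := hm i; fun_prop)
  have hXm : ∀ i, Measurable fun y : ι → ℝ => ENNReal.ofReal (Real.exp (h i (y i))) := fun i => by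
    have := hm i; fun_prop
  have e1 := lintegral_prod_eq_prod_lintegral_of_indepFun Finset.univ _ hX hXm
  have e2 : ∀ i, ∫⁻ y : ι → ℝ, ENNReal.ofReal (Real.exp (h i (y i))) ∂Measure.pi μ
      = ∫⁻ y, ENNReal.ofReal (Real.exp (h i y)) ∂μ i := fun i =>
    (measurePreserving_eval μ i).lintegral_comp
      (f := fun y => ENNReal.ofReal (Real.exp (h i y))) (by have := hm i; fun_prop)
  have e3 : ∀ y : ι → ℝ, ∏ i, ENNReal.ofReal (Real.exp (h i (y i)))
      = ENNReal.ofReal (Real.exp (∑ i, h i (y i))) := fun y => by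
    rw [Real.exp_sum, ENNReal.ofReal_prod_of_nonneg fun i _ => (Real.exp_pos _).le]
  have e4 : ∫⁻ y, ENNReal.ofReal (Real.exp (∑ i, h i (y i))) ∂Measure.pi μ
      ≤ ENNReal.ofReal (Real.exp (∑ i, β i)) := by
    simp_rw [e3, e2] at e1
    rw [e1, Real.exp_sum, ENNReal.ofReal_prod_of_nonneg fun i _ => (Real.exp_pos _).le]
    exact Finset.prod_le_prod' fun i _ => hβ i
  have hmk := mul_meas_ge_le_lintegral (μ := Measure.pi μ)
    (f := fun y : ι → ℝ => ENNReal.ofReal (Real.exp (∑ i, h i (y i)))) (by fun_prop)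
    (ENNReal.ofReal (Real.exp T))
  have hset : {y : ι → ℝ | ENNReal.ofReal (Real.exp T) ≤ ENNReal.ofReal (Real.exp (∑ i, h i (y i)))}
      = {y | T ≤ ∑ i, h i (y i)} := by
    ext y
    simp [ENNReal.ofReal_le_ofReal_iff (Real.exp_pos _).le]
  rw [hset] at hmk
  have h5 := hmk.trans e4
  rw [Real.exp_sub, ENNReal.ofReal_div_of_pos (Real.exp_pos _), ENNReal.le_div_iff_mul_le
    (Or.inl (by simp [Real.exp_pos])) (Or.inl ENNReal.ofReal_ne_top), mul_comm]
  exact h5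

/-! ### Exponential moments of one Gaussian -/

/-- Exponential moment of the square of a shifted centred Gaussian. -/
theorem lintegral_exp_mul_sq_gaussianReal_le (v : NNReal) {a c : ℝ} (ha : 2 * a * v < 1)
    (hac : a * c ^ 2 ≤ 0) :
    ∫⁻ y, ENNReal.ofReal (Real.exp (a * (y + c) ^ 2)) ∂gaussianReal 0 v
      ≤ ENNReal.ofReal (1 / √(1 - 2 * a * v)) := by
  by_cases hv : v = 0
  · subst hv
    simpa [gaussianReal_zero_var] using hac
  have hv0 : 0 < (v : ℝ) := by positivity
  set b : ℝ := 1 / (2 * v) - a with hb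
  have hb0 : 0 < b := by
    rw [hb, sub_pos, lt_div_iff₀ (by positivity)]; linarith
  have hbv : 1 - 2 * a * v = 2 * v * b := by rw [hb]; field_simp
  rw [gaussianReal_of_var_ne_zero _ hv, lintegral_withDensity_eq_lintegral_mul _
    (measurable_gaussianPDF 0 v) (by fun_prop)]
  have hle : ∀ y : ℝ, (gaussianPDF 0 v * fun y => ENNReal.ofReal (Real.exp (a * (y + c) ^ 2))) y ≤
      ENNReal.ofReal ((√(2 * Real.pi * v))⁻¹ * Real.exp (-b * (y + -(a * c / b)) ^ 2)) := by
    intro y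
    simp only [Pi.mul_apply, gaussianPDF, gaussianPDFReal]
    rw [← ENNReal.ofReal_mul (by positivity), mul_assoc, ← Real.exp_add]
    refine ENNReal.ofReal_le_ofReal ?_
    gcongr
    -- Completing the square leaves a constant with the sign of `a * c ^ 2`, which can be dropped.
    -- This covers both `c = 0` with any `a` and any `c` with `a ≤ 0`.
    have hid : -(y - 0) ^ 2 / (2 * v) + a * (y + c) ^ 2
        = -b * (y + -(a * c / b)) ^ 2 + a * c ^ 2 * (1 / (2 * v) / b) := by
      have h1 : 1 / (2 * (v : ℝ)) = b + a := by rw [hb]; ring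
      have h2 : -(y - 0) ^ 2 / (2 * v) = -(y ^ 2 * (1 / (2 * (v : ℝ)))) := by ring
      rw [h2, h1]
      field_simp
      ring
    rw [hid]
    have : a * c ^ 2 * (1 / (2 * v) / b) ≤ 0 :=
      mul_nonpos_of_nonpos_of_nonneg hac (by positivity)
    linarith
  refine (lintegral_mono hle).trans ?_
  rw [lintegral_add_right_eq_self (μ := volume)
    (fun y : ℝ => ENNReal.ofReal ((√(2 * Real.pi * v))⁻¹ * Real.exp (-b * y ^ 2))),
    ← ofReal_integral_eq_lintegral_ofReal ((integrable_exp_neg_mul_sq hb0).const_mul _)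
      (Filter.Eventually.of_forall fun y => by positivity),
    integral_const_mul, integral_gaussian, hbv]
  refine ENNReal.ofReal_le_ofReal (le_of_eq ?_)
  rw [← Real.sqrt_inv, ← Real.sqrt_mul (by positivity), one_div, ← Real.sqrt_inv]
  congr 1
  field_simp

/-- With `u = 2sv ≤ 1/2` this is `1 / √(1 - u) ≤ e^{(u + u²)/2}`, which follows from the quadratic
lower bound for the exponential. -/
theorem lintegral_exp_mul_sq_gaussianReal_le_exp (v : NNReal) {s : ℝ} (hs : 0 ≤ s)
    (hsv : 4 * s * v ≤ 1) :
    ∫⁻ y, ENNReal.ofReal (Real.exp (s * y ^ 2)) ∂gaussianReal 0 v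
      ≤ ENNReal.ofReal (Real.exp (s * v + 2 * (s * v) ^ 2)) := by
  have h := lintegral_exp_mul_sq_gaussianReal_le v (a := s) (c := 0) (by linarith) (by simp)
  simp only [add_zero] at h
  refine h.trans (ENNReal.ofReal_le_ofReal ?_)
  set u : ℝ := 2 * s * v with hu
  have hu0 : 0 ≤ u := by positivity
  have hu1 : u ≤ 1 / 2 := by rw [hu]; linarith
  have hkey : 1 ≤ (1 - u) * Real.exp (u + u ^ 2) := by
    have h1 := Real.quadratic_le_exp_of_nonneg (x := u + u ^ 2) (by positivity)
    have h2 : 1 ≤ (1 - u) * (1 + (u + u ^ 2) + (u + u ^ 2) ^ 2 / 2) := by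
      have : 0 ≤ u ^ 2 * ((1 - u) * (1 + u) ^ 2 - 2 * u) := by
        refine mul_nonneg (by positivity) ?_
        nlinarith [mul_nonneg hu0 hu0, mul_nonneg hu0 (sub_nonneg.2 hu1)]
      nlinarith
    exact h2.trans (by gcongr; linarith)
  have he : Real.exp (s * v + 2 * (s * v) ^ 2) = √(Real.exp (u + u ^ 2)) := by
    rw [← Real.exp_half]; congr 1; rw [hu]; ring
  rw [he, div_le_iff₀ (Real.sqrt_pos.2 (by linarith)), ← Real.sqrt_mul (Real.exp_pos _).le,
    Real.one_le_sqrt]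
  linarith

/-- Only a lower bound `τ` on the variance is available, and `-u + u²` is not monotone. So `v` is
replaced by `τ` inside `1 / √(1 + 2sv)`, which is decreasing, before `log (1 + u) ≥ u - u²/2` is
used. -/
theorem lintegral_exp_neg_mul_sq_gaussianReal_le_exp (v : NNReal) {s τ : ℝ} (c : ℝ) (hs : 0 ≤ s)
    (hτ : 0 ≤ τ) (hτv : τ ≤ v) :
    ∫⁻ y, ENNReal.ofReal (Real.exp (-s * (y + c) ^ 2)) ∂gaussianReal 0 v
      ≤ ENNReal.ofReal (Real.exp (-(s * τ) + (s * τ) ^ 2)) := by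
  have hsv : 0 ≤ s * v := by positivity
  have h := lintegral_exp_mul_sq_gaussianReal_le v (a := -s) (c := c) (by linarith)
    (by nlinarith [sq_nonneg c])
  refine h.trans (ENNReal.ofReal_le_ofReal ?_)
  set u : ℝ := 2 * s * τ with hu
  have hu0 : 0 ≤ u := by positivity
  have huv : u ≤ 2 * s * v := by rw [hu]; gcongr
  have hlog : u - u ^ 2 / 2 ≤ Real.log (1 + u) := by
    refine le_trans ?_ (Real.le_log_one_add_of_nonneg hu0)
    rw [le_div_iff₀ (by positivity)]
    nlinarith [pow_nonneg hu0 3]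
  have hkey : Real.exp (u - u ^ 2 / 2) ≤ 1 - 2 * -s * v :=
    ((Real.le_log_iff_exp_le (by positivity)).1 hlog).trans (by linarith)
  have he : Real.exp (-(s * τ) + (s * τ) ^ 2) = 1 / √(Real.exp (u - u ^ 2 / 2)) := by
    rw [← Real.exp_half, one_div, ← Real.exp_neg]; congr 1; rw [hu]; ring
  rw [he]
  exact one_div_le_one_div_of_le (Real.sqrt_pos.2 (Real.exp_pos _)) (Real.sqrt_le_sqrt hkey)

theorem lintegral_exp_mul_gaussianReal (v : NNReal) (s : ℝ) :
    ∫⁻ y, ENNReal.ofReal (Real.exp (s * y)) ∂gaussianReal 0 v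
      = ENNReal.ofReal (Real.exp (v * s ^ 2 / 2)) := by
  have h := mgf_gaussianReal (p := gaussianReal 0 v) (X := id) (μ := 0) (v := v) (by simp) s
  rw [← ofReal_integral_eq_lintegral_ofReal (integrable_exp_mul_gaussianReal s)
    (Filter.Eventually.of_forall fun y => by positivity)]
  simp only [mgf, id] at h
  rw [h]; simp

theorem lintegral_sq_add_mul_gaussianReal (v : NNReal) (a b : ℝ) :
    ∫⁻ y, ENNReal.ofReal ((a + b * y) ^ 2) ∂gaussianReal 0 v
      = ENNReal.ofReal (a ^ 2 + b ^ 2 * v) := by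
  have hL : MemLp (fun y : ℝ => a + b * y) 2 (gaussianReal 0 v) :=
    (memLp_const a).add ((memLp_id_gaussianReal 2).const_mul b)
  rw [← ofReal_integral_eq_lintegral_ofReal hL.integrable_sq
    (Filter.Eventually.of_forall fun y => by positivity)]
  congr 1
  have hi : Integrable (fun y : ℝ => y) (gaussianReal 0 v) :=
    (memLp_id_gaussianReal 1).integrable le_rfl
  have hvar := variance_eq_sub hL
  have hmean : ∫ y, (a + b * y) ∂gaussianReal 0 v = a := by
    rw [integral_add (integrable_const _) (hi.const_mul b), integral_const_mul,
      integral_id_gaussianReal]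
    simp
  have hv : Var[fun y : ℝ => a + b * y; gaussianReal 0 v] = b ^ 2 * v := by
    rw [variance_const_add (by fun_prop), variance_const_mul, variance_fun_id_gaussianReal]
  rw [hv, hmean] at hvar
  simp only [Pi.pow_apply] at hvar
  linarith

/-! ### Sums of independent Gaussians and the posterior decomposition -/

/-- Coordinatewise combination of two independent vectors with independent coordinates. -/
theorem measurePreserving_prod_pi {ι α β γ : Type*} [Fintype ι] [MeasurableSpace α]
    [MeasurableSpace β] [MeasurableSpace γ] {μ : ι → Measure α} {ν : ι → Measure β}
    {κ : ι → Measure γ} [∀ i, SigmaFinite (μ i)] [∀ i, SigmaFinite (ν i)] [∀ i, SigmaFinite (κ i)]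
    {φ : ι → α × β → γ} (hφ : ∀ i, MeasurePreserving (φ i) ((μ i).prod (ν i)) (κ i)) :
    MeasurePreserving (fun (p : (ι → α) × (ι → β)) i => φ i (p.1 i, p.2 i))
      ((Measure.pi μ).prod (Measure.pi ν)) (Measure.pi κ) :=
  (measurePreserving_pi _ κ hφ).comp
    ((measurePreserving_arrowProdEquivProdArrow α β ι μ ν).symm)

theorem map_linear_gaussianReal_prod (a b : NNReal) (c d : ℝ) :
    ((gaussianReal 0 a).prod (gaussianReal 0 b)).map (fun p => c * p.1 + d * p.2)
      = gaussianReal 0 (.mk (c ^ 2) (sq_nonneg _) * a + .mk (d ^ 2) (sq_nonneg _) * b) := by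
  have h := gaussianReal_add_gaussianReal_of_indepFun
    (P := (gaussianReal 0 a).prod (gaussianReal 0 b))
    (X := fun p => c * p.1) (Y := fun p => d * p.2)
    (m₁ := 0) (m₂ := 0) (v₁ := .mk (c ^ 2) (sq_nonneg _) * a)
    (v₂ := .mk (d ^ 2) (sq_nonneg _) * b)
    (indepFun_prod (X := fun x : ℝ => c * x) (Y := fun x : ℝ => d * x) (by fun_prop) (by fun_prop))
    ?_ ?_
  · rw [add_zero] at h
    exact h
  · have : (fun p : ℝ × ℝ => c * p.1) = (fun x => c * x) ∘ Prod.fst := rfl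
    rw [this, ← Measure.map_map (by fun_prop) (by fun_prop), Measure.map_fst_prod, measure_univ,
      one_smul, gaussianReal_map_const_mul, mul_zero]
  · have : (fun p : ℝ × ℝ => d * p.2) = (fun x => d * x) ∘ Prod.snd := rfl
    rw [this, ← Measure.map_map (by fun_prop) (by fun_prop), Measure.map_snd_prod, measure_univ,
      one_smul, gaussianReal_map_const_mul, mul_zero]

theorem measurePreserving_add_gaussianReal (a b : NNReal) :
    MeasurePreserving (fun p : ℝ × ℝ => p.1 + p.2) ((gaussianReal 0 a).prod (gaussianReal 0 b))
      (gaussianReal 0 (a + b)) := by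
  refine ⟨by fun_prop, ?_⟩
  have h := map_linear_gaussianReal_prod a b 1 1
  simp only [one_mul] at h
  rw [h]
  congr 1
  ext
  simp

/-- The observation `g + w` and the residual of the linear estimate of `g` from it are independent
centred Gaussians. -/
theorem measurePreserving_posterior_gaussianReal (a b : NNReal) (hb : b ≠ 0) :
    MeasurePreserving (fun p : ℝ × ℝ => (p.1 + p.2, p.1 - a / (a + b) * (p.1 + p.2)))
      ((gaussianReal 0 a).prod (gaussianReal 0 b))
      ((gaussianReal 0 (a + b)).prod (gaussianReal 0 (a * b / (a + b)))) := by
  refine ⟨by fun_prop, ?_⟩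
  set P := (gaussianReal 0 a).prod (gaussianReal 0 b) with hP
  have hs : (0 : ℝ) < a + b := by positivity
  have hfst : HasGaussianLaw (fun p : ℝ × ℝ => p.1) P :=
    ⟨by rw [hP, show (fun p : ℝ × ℝ => p.1) = Prod.fst from rfl, Measure.map_fst_prod,
        measure_univ, one_smul]; infer_instance⟩
  have hsnd : HasGaussianLaw (fun p : ℝ × ℝ => p.2) P :=
    ⟨by rw [hP, show (fun p : ℝ × ℝ => p.2) = Prod.snd from rfl, Measure.map_snd_prod,
        measure_univ, one_smul]; infer_instance⟩
  have hind : IndepFun (fun p : ℝ × ℝ => p.1) (fun p : ℝ × ℝ => p.2) P :=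
    indepFun_prod (X := fun x : ℝ => x) (Y := fun x : ℝ => x) (by fun_prop) (by fun_prop)
  have hpair := IndepFun.hasGaussianLaw hfst hsnd hind
  -- Joint normality reduces independence to a covariance; the weight `a / (a + b)` is the one that
  -- makes it vanish.
  have hjoint : HasGaussianLaw
      (fun p : ℝ × ℝ => (p.1 + p.2, p.1 - (a : ℝ) / (a + b) * (p.1 + p.2))) P := by
    have := hpair.map_fun (((ContinuousLinearMap.fst ℝ ℝ ℝ + ContinuousLinearMap.snd ℝ ℝ ℝ).prod
      (ContinuousLinearMap.fst ℝ ℝ ℝ - ((a : ℝ) / (a + b)) •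
        (ContinuousLinearMap.fst ℝ ℝ ℝ + ContinuousLinearMap.snd ℝ ℝ ℝ))))
    exact this
  have hcov : cov[fun p : ℝ × ℝ => p.1 + p.2,
      fun p : ℝ × ℝ => p.1 - (a : ℝ) / (a + b) * (p.1 + p.2); P] = 0 := by
    have L1 := hfst.memLp_two
    have L2 := hsnd.memLp_two
    have c12 := hind.covariance_eq_zero L1 L2
    have c21 : cov[fun p : ℝ × ℝ => p.2, fun p : ℝ × ℝ => p.1; P] = 0 := by
      rw [covariance_comm]; exact c12
    have c11 : cov[fun p : ℝ × ℝ => p.1, fun p : ℝ × ℝ => p.1; P] = a := by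
      rw [covariance_self (by fun_prop), ← variance_fun_id_gaussianReal (μ := 0) (v := a)]
      exact (measurePreserving_fst (μ := gaussianReal 0 a)
        (ν := gaussianReal 0 b)).variance_fun_comp (f := fun x => x) (by fun_prop)
    have c22 : cov[fun p : ℝ × ℝ => p.2, fun p : ℝ × ℝ => p.2; P] = b := by
      rw [covariance_self (by fun_prop), ← variance_fun_id_gaussianReal (μ := 0) (v := b)]
      exact (measurePreserving_snd (μ := gaussianReal 0 a)
        (ν := gaussianReal 0 b)).variance_fun_comp (f := fun x => x) (by fun_prop)
    rw [covariance_fun_sub_right (X := fun p : ℝ × ℝ => p.1 + p.2) (Y := fun p : ℝ × ℝ => p.1)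
        (Z := fun p : ℝ × ℝ => (a : ℝ) / (a + b) * (p.1 + p.2)) (L1.add L2) L1
        ((L1.add L2).const_mul _),
      covariance_const_mul_right]
    change cov[(fun p : ℝ × ℝ => p.1) + (fun p : ℝ × ℝ => p.2), _; P] -
      _ * cov[(fun p : ℝ × ℝ => p.1) + (fun p : ℝ × ℝ => p.2),
        (fun p : ℝ × ℝ => p.1) + (fun p : ℝ × ℝ => p.2); P] = 0
    rw [covariance_add_left L1 L2 L1, covariance_add_left L1 L2 (L1.add L2),
      covariance_add_right L1 L1 L2, covariance_add_right L2 L1 L2, c11, c22, c12, c21]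
    field_simp
    ring
  have hI := hjoint.indepFun_of_covariance_eq_zero hcov
  rw [indepFun_iff_map_prod_eq_prod_map_map (by fun_prop) (by fun_prop)] at hI
  rw [hI, (measurePreserving_add_gaussianReal a b).map_eq]
  congr 1
  -- In this form the variance of the residual is `(b² a + a² b) / (a + b)² = ab / (a + b)`.
  have he : (fun p : ℝ × ℝ => p.1 - (a : ℝ) / (a + b) * (p.1 + p.2))
      = fun p => (b / (a + b) : ℝ) * p.1 + (-(a / (a + b)) : ℝ) * p.2 := by
    funext p; field_simp; ring
  rw [he, map_linear_gaussianReal_prod]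
  congr 1
  ext
  push_cast
  field_simp
  ring

section Vec

variable {n : ℕ} {v w : Fin n → ℝ}

theorem measurePreserving_add_gaussianVec (hv : ∀ i, 0 ≤ v i) (hw : ∀ i, 0 ≤ w i) :
    MeasurePreserving (fun p : (Fin n → ℝ) × (Fin n → ℝ) => p.1 + p.2)
      ((gaussianVec v).prod (gaussianVec w)) (gaussianVec (v + w)) := by
  refine measurePreserving_prod_pi (μ := fun i => gaussianReal 0 (v i).toNNReal)
    (ν := fun i => gaussianReal 0 (w i).toNNReal)
    (κ := fun i => gaussianReal 0 ((v + w) i).toNNReal) (φ := fun _ p => p.1 + p.2) fun i => ?_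
  rw [Pi.add_apply, Real.toNNReal_add (hv i) (hw i)]
  exact measurePreserving_add_gaussianReal _ _

theorem measurePreserving_mul_gaussianIID (u : Fin n → ℝ) {ρ : ℝ} :
    MeasurePreserving (fun g => u * g) (gaussianIID n ρ) (gaussianVec fun i => u i ^ 2 * ρ) := by
  refine measurePreserving_pi (fun _ => gaussianReal 0 ρ.toNNReal)
    (fun i => gaussianReal 0 (u i ^ 2 * ρ).toNNReal) (f := fun i x => u i * x)
    fun i => ⟨by fun_prop, ?_⟩
  rw [gaussianReal_map_const_mul, mul_zero]
  congr 1
  rw [Real.toNNReal_mul (sq_nonneg _)]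
  congr 1
  ext
  simp [sq_nonneg]

/-- Vector form of the decomposition into an observation and an independent residual. -/
theorem measurePreserving_posterior_gaussianVec (hv : ∀ i, 0 ≤ v i) (hw : ∀ i, 0 < w i) :
    MeasurePreserving (fun p : (Fin n → ℝ) × (Fin n → ℝ) =>
        (p.1 + p.2, fun i => p.1 i - v i / (v i + w i) * (p.1 i + p.2 i)))
      ((gaussianVec v).prod (gaussianVec w))
      ((gaussianVec (v + w)).prod (gaussianVec fun i => v i * w i / (v i + w i))) := by
  refine (measurePreserving_arrowProdEquivProdArrow ℝ ℝ (Fin n)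
    (fun i => gaussianReal 0 ((v + w) i).toNNReal)
    (fun i => gaussianReal 0 (v i * w i / (v i + w i)).toNNReal)).comp
    (measurePreserving_prod_pi (μ := fun i => gaussianReal 0 (v i).toNNReal)
      (ν := fun i => gaussianReal 0 (w i).toNNReal)
      (φ := fun i p => (p.1 + p.2, p.1 - v i / (v i + w i) * (p.1 + p.2))) fun i => ?_)
  have h := measurePreserving_posterior_gaussianReal (v i).toNNReal (w i).toNNReal
    (by simpa using hw i)
  rw [Real.coe_toNNReal _ (hv i), Real.coe_toNNReal _ (hw i).le] at h
  have e1 : (v + w) i = v i + w i := rfl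
  rw [e1, Real.toNNReal_add (hv i) (hw i).le, Real.toNNReal_div (mul_nonneg (hv i) (hw i).le),
    Real.toNNReal_mul (hv i), Real.toNNReal_add (hv i) (hw i).le]
  exact h

end Vec

/-! ### Gaussian tail bounds and the attack bound -/

section Tails

variable {n : ℕ} {v w u : Fin n → ℝ}

theorem gaussianVec_sum_mul_ge_le (hv : ∀ i, 0 ≤ v i) (x : Fin n → ℝ) {s : ℝ} (hs : 0 < s) (T : ℝ) :
    gaussianVec v {y | T ≤ ∑ i, x i * y i}
      ≤ ENNReal.ofReal (Real.exp (∑ i, v i * (s * x i) ^ 2 / 2 - s * T)) := by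
  refine le_trans (measure_mono ?_) (measure_pi_sum_ge_le (fun i => gaussianReal 0 (v i).toNNReal)
    (h := fun i y => s * x i * y) (fun i => by fun_prop)
    (β := fun i => v i * (s * x i) ^ 2 / 2) (fun i => ?_) (s * T))
  · intro y hy
    simp only [Set.mem_ofPred_eq] at hy ⊢
    simp_rw [mul_assoc, ← Finset.mul_sum]
    gcongr
  · rw [lintegral_exp_mul_gaussianReal, Real.coe_toNNReal _ (hv i)]

theorem gaussianVec_sum_sq_ge_le (hv : ∀ i, 0 ≤ v i) (L : Finset (Fin n)) {s : ℝ} (hs : 0 < s)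
    (hsv : ∀ i ∈ L, 4 * s * v i ≤ 1) (T : ℝ) :
    gaussianVec v {y | T ≤ ∑ i ∈ L, y i ^ 2}
      ≤ ENNReal.ofReal (Real.exp (∑ i ∈ L, (s * v i + 2 * (s * v i) ^ 2) - s * T)) := by
  -- Coordinates outside `L` carry the zero function, whose exponential moment is 1.
  have h := measure_pi_sum_ge_le (fun i => gaussianReal 0 (v i).toNNReal)
    (h := fun i y => if i ∈ L then s * y ^ 2 else 0)
    (fun i => by split_ifs <;> fun_prop)
    (β := fun i => if i ∈ L then s * v i + 2 * (s * v i) ^ 2 else 0) (fun i => ?_) (s * T)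
  · simp only [Finset.sum_ite_mem, Finset.univ_inter] at h
    refine le_trans (measure_mono ?_) h
    intro y hy
    simp only [Set.mem_ofPred_eq] at hy ⊢
    rw [← Finset.mul_sum]
    gcongr
  · split_ifs with hi
    · have := lintegral_exp_mul_sq_gaussianReal_le_exp (v i).toNNReal hs.le
        (by rw [Real.coe_toNNReal _ (hv i)]; exact hsv i hi)
      rwa [Real.coe_toNNReal _ (hv i)] at this
    · simp

theorem gaussianVec_sum_sq_add_le_le (L : Finset (Fin n)) (c : Fin n → ℝ)
    {τ : Fin n → ℝ} (hτ : ∀ i ∈ L, 0 ≤ τ i) (hτv : ∀ i ∈ L, τ i ≤ v i) {s : ℝ} (hs : 0 ≤ s)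
    (T : ℝ) :
    gaussianVec v {y | ∑ i ∈ L, (y i + c i) ^ 2 ≤ T}
      ≤ ENNReal.ofReal (Real.exp (∑ i ∈ L, (-(s * τ i) + (s * τ i) ^ 2) + s * T)) := by
  have h := measure_pi_sum_ge_le (fun i => gaussianReal 0 (v i).toNNReal)
    (h := fun i y => if i ∈ L then -s * (y + c i) ^ 2 else 0)
    (fun i => by split_ifs <;> fun_prop)
    (β := fun i => if i ∈ L then -(s * τ i) + (s * τ i) ^ 2 else 0) (fun i => ?_) (-s * T)
  · simp only [Finset.sum_ite_mem, Finset.univ_inter] at h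
    rw [neg_mul, sub_neg_eq_add] at h
    refine le_trans (measure_mono ?_) h
    intro y hy
    simp only [Set.mem_ofPred_eq] at hy ⊢
    rw [← Finset.mul_sum, neg_mul]
    have := mul_le_mul_of_nonneg_left hy hs
    linarith
  · split_ifs with hi
    · exact lintegral_exp_neg_mul_sq_gaussianReal_le_exp _ _ hs (hτ i hi)
        ((hτv i hi).trans (Real.le_coe_toNNReal _))
    · simp

/-- The noisy observation of the signal is independent of the residual plus a second noise. -/
theorem measurePreserving_observation_residual (hv : ∀ i, 0 ≤ v i) (hu : ∀ i, 0 ≤ u i)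
    (hw : ∀ i, 0 < w i) :
    MeasurePreserving (fun p : (Fin n → ℝ) × ((Fin n → ℝ) × (Fin n → ℝ)) =>
        (p.1 + p.2.2, (fun i => p.1 i - v i / (v i + w i) * (p.1 i + p.2.2 i)) + p.2.1))
      ((gaussianVec v).prod ((gaussianVec u).prod (gaussianVec w)))
      ((gaussianVec (v + w)).prod (gaussianVec ((fun i => v i * w i / (v i + w i)) + u))) := by
  -- The noises are swapped and reassociated so that signal and `w` form a pair; that pair becomes
  -- observation and residual, and `u` is then added to the residual.
  have m1 : MeasurePreserving
      (fun p : (Fin n → ℝ) × ((Fin n → ℝ) × (Fin n → ℝ)) => (p.1, (p.2.2, p.2.1)))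
      ((gaussianVec v).prod ((gaussianVec u).prod (gaussianVec w)))
      ((gaussianVec v).prod ((gaussianVec w).prod (gaussianVec u))) :=
    (MeasurePreserving.id _).prod Measure.measurePreserving_swap
  have m2 := (measurePreserving_prodAssoc (gaussianVec v) (gaussianVec w) (gaussianVec u)).symm
  have m3 := (measurePreserving_posterior_gaussianVec hv hw).prod
    (MeasurePreserving.id (gaussianVec u))
  have m4 := measurePreserving_prodAssoc (gaussianVec (v + w))
    (gaussianVec fun i => v i * w i / (v i + w i)) (gaussianVec u)
  have m5 := (MeasurePreserving.id (gaussianVec (v + w))).prod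
    (measurePreserving_add_gaussianVec (v := fun i => v i * w i / (v i + w i))
      (fun i => div_nonneg (mul_nonneg (hv i) (hw i).le) (add_nonneg (hv i) (hw i).le)) hu)
  exact m5.comp (m4.comp (m3.comp (m2.comp m1)))

/-- Small-ball bound for the signal plus an independent noise, shifted by an arbitrary function of
a noisy observation of the signal. -/
theorem gaussianVec_attack_le (hv : ∀ i, 0 ≤ v i) (hu : ∀ i, 0 ≤ u i) (hw : ∀ i, 0 < w i)
    {z : (Fin n → ℝ) → Fin n → ℝ} (hz : Measurable z) (L : Finset (Fin n))
    {τ : Fin n → ℝ} (hτ : ∀ i ∈ L, 0 ≤ τ i)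
    (hτv : ∀ i ∈ L, τ i ≤ v i * w i / (v i + w i) + u i) {s : ℝ} (hs : 0 ≤ s) (T : ℝ) :
    ((gaussianVec v).prod ((gaussianVec u).prod (gaussianVec w)))
        {p | ∑ i ∈ L, (p.1 i + p.2.1 i + z (p.1 + p.2.2) i) ^ 2 ≤ T}
      ≤ ENNReal.ofReal (Real.exp (∑ i ∈ L, (-(s * τ i) + (s * τ i) ^ 2) + s * T)) := by
  -- The signal is its linear estimate plus the residual. The estimate joins the attack in a single
  -- shift that depends on the observation alone.
  set S : Set ((Fin n → ℝ) × (Fin n → ℝ)) :=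
    {q | ∑ i ∈ L, (q.2 i + (v i / (v i + w i) * q.1 i + z q.1 i)) ^ 2 ≤ T} with hS
  have hzi : ∀ i, Measurable fun q : (Fin n → ℝ) × (Fin n → ℝ) => z q.1 i := fun i =>
    (measurable_pi_apply i).comp (hz.comp measurable_fst)
  have hSm : MeasurableSet S :=
    measurableSet_le (Finset.measurable_sum _ fun i _ => by have := hzi i; fun_prop)
      measurable_const
  have hpre := (measurePreserving_observation_residual hv hu hw).measure_preimage
    hSm.nullMeasurableSet
  have hset : {p : (Fin n → ℝ) × ((Fin n → ℝ) × (Fin n → ℝ)) |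
        ∑ i ∈ L, (p.1 i + p.2.1 i + z (p.1 + p.2.2) i) ^ 2 ≤ T}
      = (fun p : (Fin n → ℝ) × ((Fin n → ℝ) × (Fin n → ℝ)) =>
        (p.1 + p.2.2, (fun i => p.1 i - v i / (v i + w i) * (p.1 i + p.2.2 i)) + p.2.1)) ⁻¹' S := by
    ext p
    simp only [hS, Set.mem_preimage, Set.mem_ofPred_eq, Pi.add_apply]
    rw [Finset.sum_congr rfl fun i _ => ?_]
    ring
  rw [hset, hpre, Measure.prod_apply hSm]
  -- For a fixed observation the shift is a constant vector, and the bound does not depend on it;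
  -- Fubini finishes.
  have hU : ∀ U : Fin n → ℝ,
      gaussianVec ((fun i => v i * w i / (v i + w i)) + u) (Prod.mk U ⁻¹' S)
        ≤ ENNReal.ofReal (Real.exp (∑ i ∈ L, (-(s * τ i) + (s * τ i) ^ 2) + s * T)) := fun U =>
    gaussianVec_sum_sq_add_le_le (v := (fun i => v i * w i / (v i + w i)) + u) L
      (fun i => v i / (v i + w i) * U i + z U i) hτ hτv hs T
  calc _ ≤ ∫⁻ _, ENNReal.ofReal (Real.exp (∑ i ∈ L, (-(s * τ i) + (s * τ i) ^ 2) + s * T))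
        ∂gaussianVec (v + w) := lintegral_mono hU
    _ = _ := by rw [lintegral_const, measure_univ, mul_one]

end Tails

/-! ### Levels, residual variances and the detection exponent -/

section Levels

theorem nextLevel_mem {K : Finset ℝ} {k : ℝ} (hk : k < 1) :
    nextLevel K k ∈ tildeK K ∧ k < nextLevel K k := by
  have hfin : {d : ℝ | d ∈ tildeK K ∧ k < d}.Finite :=
    (tildeK K).finite_toSet.subset fun d hd => hd.1
  have hne : {d : ℝ | d ∈ tildeK K ∧ k < d}.Nonempty := ⟨1, Finset.mem_insert_self 1 K, hk⟩
  exact hne.csInf_mem hfin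

theorem nextLevel_le {K : Finset ℝ} {k d : ℝ} (hd : d ∈ tildeK K) (hkd : k < d) :
    nextLevel K k ≤ d :=
  csInf_le ⟨k, fun _ he => he.2.le⟩ ⟨hd, hkd⟩

variable {ρΔ ρDec ρAdv : ℝ}

theorem tauStar_mono (hΔ : 0 < ρΔ) (hAdv : 0 < ρAdv) {a b : ℝ} (ha : 0 ≤ a) (hab : a ≤ b) :
    tauStar ρΔ ρDec ρAdv a ≤ tauStar ρΔ ρDec ρAdv b := by
  unfold tauStar
  have h : a ^ 2 * ρΔ ≤ b ^ 2 * ρΔ := by gcongr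
  have h0 : 0 ≤ a ^ 2 * ρΔ := by positivity
  gcongr ?_ + _
  rw [div_le_div_iff₀ (by positivity) (by positivity)]
  nlinarith [mul_le_mul_of_nonneg_right h (sq_nonneg ρAdv)]

theorem tauStar_pos (hΔ : 0 < ρΔ) (hDec : 0 < ρDec) (hAdv : 0 < ρAdv) (a : ℝ) :
    0 < tauStar ρΔ ρDec ρAdv a := by
  unfold tauStar; positivity

theorem detectionGap_nonneg (K : Finset ℝ) (γ ρΔ ρDec ρAdv δ : ℝ) :
    0 ≤ detectionGap K γ ρΔ ρDec ρAdv δ := le_max_left _ _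

theorem threshold_le_of_detectionGap_pos {K : Finset ℝ} {γ δ k : ℝ}
    (hg : 0 < detectionGap K γ ρΔ ρDec ρAdv δ) (hk : k ∈ K)
    (hpos : 0 < γ * tauStar ρΔ ρDec ρAdv k + (1 - γ) * tauStar ρΔ ρDec ρAdv (nextLevel K k)) :
    (1 + δ) * (k ^ 2 * ρΔ + ρDec) ≤ (1 - detectionGap K γ ρΔ ρDec ρAdv δ) *
      (γ * tauStar ρΔ ρDec ρAdv k + (1 - γ) * tauStar ρΔ ρDec ρAdv (nextLevel K k)) := by
  have h1 : detectionGap K γ ρΔ ρDec ρAdv δ ≤ 1 - (1 + δ) * (k ^ 2 * ρΔ + ρDec) /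
      (γ * tauStar ρΔ ρDec ρAdv k + (1 - γ) * tauStar ρΔ ρDec ρAdv (nextLevel K k)) := by
    unfold detectionGap at hg ⊢
    rw [max_eq_right (by by_contra hc; rw [max_eq_left (not_le.1 hc).le] at hg; exact hg.false)]
    exact ciInf_le (Set.finite_range _).bddBelow (⟨k, hk⟩ : K)
  rw [← div_le_iff₀ hpos]
  linarith

/-- Put `q = lam / 2` and `x = τk / τd`. As `-u + u²` decreases on `[0, 1/2]`, the worst case is `A
= γℓ`. There the exponent is at most `-ℓ q² (γ x (2 - x) + 1 - γ)`, of which half of the `1 - γ`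
part is enough. -/
theorem detection_exponent_le {ℓ A γ lam τk τd T : ℝ} (hℓ : 0 ≤ ℓ) (hA : A ≤ γ * ℓ)
    (hγ : γ < 1) (hγ0 : 0 < γ) (hl0 : 0 < lam) (hl1 : lam ≤ 1) (hk : 0 < τk) (hkd : τk ≤ τd)
    (hT : T ≤ (1 - lam) * ℓ * (γ * τk + (1 - γ) * τd)) :
    A * (-(lam / (2 * τd) * τk) + (lam / (2 * τd) * τk) ^ 2)
      + (ℓ - A) * (-(lam / (2 * τd) * τd) + (lam / (2 * τd) * τd) ^ 2) + lam / (2 * τd) * T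
      ≤ -(1 / 8 * ℓ * (1 - γ) * lam ^ 2) := by
  have hd : 0 < τd := hk.trans_le hkd
  obtain ⟨x, rfl⟩ : ∃ x, τk = x * τd := ⟨τk / τd, by field_simp⟩
  have hx0 : 0 < x := pos_of_mul_pos_left hk hd.le
  have hx1 : x ≤ 1 := le_of_mul_le_mul_right (by linarith) hd
  obtain ⟨q, rfl⟩ : ∃ q, lam = 2 * q := ⟨lam / 2, by ring⟩
  have e1 : 2 * q / (2 * τd) * (x * τd) = q * x := by field_simp
  have e2 : 2 * q / (2 * τd) * τd = q := by field_simp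
  have e3 : 2 * q / (2 * τd) * T ≤ (1 - 2 * q) * ℓ * (q * (γ * x + (1 - γ))) := by
    have := mul_le_mul_of_nonneg_left hT (show 0 ≤ 2 * q / (2 * τd) by positivity)
    refine this.trans (le_of_eq ?_)
    field_simp
  rw [e1, e2]
  have hφ : 0 ≤ (γ * ℓ - A) * ((q - q * x) * (1 - q - q * x)) :=
    mul_nonneg (by linarith) (mul_nonneg (by nlinarith) (by nlinarith))
  have h4 : 0 ≤ ℓ * q ^ 2 * (γ * (x * (1 - x))) :=
    mul_nonneg (by positivity) (mul_nonneg hγ0.le (mul_nonneg hx0.le (by linarith)))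
  have h5 : 0 ≤ ℓ * q ^ 2 * (γ * x) := by positivity
  have h6 : 0 ≤ ℓ * q ^ 2 * (1 - γ) := mul_nonneg (by positivity) (by linarith)
  nlinarith

end Levels

theorem passesTest_of_modifiedDecoder_eq {M : Type*} {n : ℕ} {H : DetCode M n}
    {f t : M → Fin n → ℝ} {K : Finset ℝ} {ρΔ ρDec δ : ℝ} {y : Fin n → ℝ} {m : M}
    (h : modifiedDecoder H f t K ρΔ ρDec δ y = some m) :
    passesTest H.x f t K ρΔ ρDec δ y m := by
  unfold modifiedDecoder at h
  split_ifs at h with hp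
  rw [Option.some.injEq] at h
  rwa [h] at hp

/-! ### Targeted false authentication -/

section Modified

variable {M : Type*} [Fintype M] {n : ℕ}

theorem measurePreserving_encoder (H : DetCode M n) (f : M → Fin n → ℝ) (K : Finset ℝ)
    (ρΔ ρDec δ : ℝ) (t : M → Fin n → ℝ) (m : M) :
    MeasurePreserving (fun N => H.x m + t m + N) (gaussianVec fun i => f m i ^ 2 * ρΔ)
      ((modifiedCode H f K ρΔ ρDec δ t).encoder m) := by
  refine ⟨by fun_prop, ?_⟩
  rw [← (measurePreserving_mul_gaussianIID (f m)).map_eq, Measure.map_map (by fun_prop)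
    (by fun_prop)]
  rfl

theorem targetedProb_modifiedCode_le (H : DetCode M n) {ρΔ ρDec ρAdv δ γ r : ℝ} (hρΔ : 0 < ρΔ)
    (hρDec : 0 < ρDec) (hρAdv : 0 < ρAdv) (hδ : 0 < δ) {K : Finset ℝ} {f : M → Fin n → ℝ}
    (hf : IsOverlayCode r K γ f) (t : M → Fin n → ℝ)
    {Z : (Fin n → ℝ) → M → (Fin n → ℝ)} (hZ : ∀ m, Measurable fun v => Z v m) {a b : M}
    (hba : b ≠ a) (hg : 0 < detectionGap K γ ρΔ ρDec ρAdv δ) :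
    (modifiedCode H f K ρΔ ρDec δ t).targetedProb ρDec ρAdv Z a b ≤
      Real.exp (-(1 / 8 * (levelSize n K : ℝ) * (1 - γ)
        * detectionGap K γ ρΔ ρDec ρAdv δ ^ 2)) := by
  classical
  obtain ⟨hγ, hγ1⟩ := hf.gamma_mem
  -- Separation is not symmetric in the messages: the tested coordinates are those of the claimed
  -- message, so `b` comes first.
  obtain ⟨k, hk, hkA, hkj⟩ := hf.separated b a hba
  obtain ⟨hk0, hk1⟩ := hf.level_mem k hk
  obtain ⟨-, hkd⟩ := nextLevel_mem (K := K) hk1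
  set lam := detectionGap K γ ρΔ ρDec ρAdv δ with hlam
  set τk := tauStar ρΔ ρDec ρAdv k with hτk
  set τd := tauStar ρΔ ρDec ρAdv (nextLevel K k) with hτd
  have hτk0 : 0 < τk := tauStar_pos hρΔ hρDec hρAdv k
  have hτd0 : 0 < τd := tauStar_pos hρΔ hρDec hρAdv _
  have hτkd : τk ≤ τd := tauStar_mono hρΔ hρAdv hk0 hkd.le
  have hpos : 0 < γ * τk + (1 - γ) * τd :=
    add_pos (mul_pos (by linarith) hτk0) (mul_pos (by linarith) hτd0)
  have hthr := threshold_le_of_detectionGap_pos hg hk hpos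
  have hσ : 0 < k ^ 2 * ρΔ + ρDec := by positivity
  -- A positive threshold cannot be at most `1 - lam` times a positive number if `lam > 1`.
  have hl1 : lam ≤ 1 := by
    by_contra hc
    have h1 : 0 < (1 + δ) * (k ^ 2 * ρΔ + ρDec) := by positivity
    have h2 := mul_nonpos_of_nonpos_of_nonneg (by linarith : 1 - lam ≤ 0) hpos.le
    linarith
  set L := levelSet (f b) k with hL
  set ℓ : ℝ := (levelSize n K : ℝ) with hℓ
  have hcard : (L.card : ℝ) = ℓ := by rw [hL, hf.card_level b k hk]
  set T : ℝ := ℓ * (1 + δ) * (k ^ 2 * ρΔ + ρDec) with hT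
  -- A two-valued lower bound for the residual variance: where `f a` differs from `k` on `L`,
  -- separation rules out lower levels, so the level is at least `d_k`.
  set τ : Fin n → ℝ := fun i => if f a i = k then τk else τd with hτ
  have hτ0 : ∀ i ∈ L, 0 ≤ τ i := fun i _ => by
    simp only [hτ]; split_ifs <;> [exact hτk0.le; exact hτd0.le]
  have hτv : ∀ i ∈ L, τ i ≤ (f a i ^ 2 * ρΔ) * ρAdv / (f a i ^ 2 * ρΔ + ρAdv) + ρDec := by
    intro i hi
    change τ i ≤ tauStar ρΔ ρDec ρAdv (f a i)
    simp only [hτ]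
    split_ifs with hik
    · rw [hik]
    · have hmem := hf.value_mem a i
      have hgt : k < f a i := by
        rcases Finset.mem_insert.1 hmem with h1 | hK
        · rw [h1]; exact hk1
        · by_contra hc
          have hlt : f a i < k := lt_of_le_of_ne (not_lt.1 hc) hik
          have h0 := hkj _ hK hlt
          rw [Finset.card_eq_zero] at h0
          exact Finset.notMem_empty i (h0 ▸ Finset.mem_inter.2 ⟨hi, by simp [levelSet]⟩)
      exact tauStar_mono hρΔ hρAdv (hk0.trans hkd.le) (nextLevel_le hmem hgt)
  set c : Fin n → ℝ := H.x a + t a with hc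
  have hzm : Measurable fun U => c + Z (c + U) a - t b - H.x b := by
    have := (hZ a).comp (measurable_const_add c)
    exact ((this.const_add c).sub_const _).sub_const _
  -- This `s` gives `s τd = lam / 2 ≤ 1/2`, the range in which `-u + u²` decreases.
  have hatt := gaussianVec_attack_le (v := fun i => f a i ^ 2 * ρΔ) (u := fun _ => ρDec)
    (w := fun _ => ρAdv) (fun i => by positivity) (fun _ => hρDec.le) (fun _ => hρAdv) hzm L hτ0
    hτv (s := lam / (2 * τd)) (by positivity) T
  set S : Set ((Fin n → ℝ) × ((Fin n → ℝ) × (Fin n → ℝ))) :=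
    {p | ∑ i ∈ L, (((p.1 + p.2.1 + Z (p.1 + p.2.2) a) i - t b i - H.x b i)) ^ 2 ≤ T} with hS
  have hSm : MeasurableSet S := by
    have hz : Measurable fun p : (Fin n → ℝ) × ((Fin n → ℝ) × (Fin n → ℝ)) =>
        Z (p.1 + p.2.2) a := (hZ a).comp (by fun_prop)
    exact measurableSet_le (by fun_prop) measurable_const
  have hmp := (measurePreserving_encoder H f K ρΔ ρDec δ t a).prod
    (MeasurePreserving.id ((gaussianIID n ρDec).prod (gaussianIID n ρAdv)))
  have hpre := hmp.measure_preimage hSm.nullMeasurableSet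
  have hle : (((modifiedCode H f K ρΔ ρDec δ t).encoder a).prod
      ((gaussianIID n ρDec).prod (gaussianIID n ρAdv)))
      {p | modifiedDecoder H f t K ρΔ ρDec δ (p.1 + p.2.1 + Z (p.1 + p.2.2) a) = some b}
      ≤ ENNReal.ofReal (Real.exp (-(1 / 8 * ℓ * (1 - γ) * lam ^ 2))) := by
    calc _ ≤ _ := measure_mono (t := S) ?_
      _ = _ := hpre.symm
      _ ≤ _ := (le_of_eq (congrArg _ ?_)).trans hatt
      _ ≤ _ := ENNReal.ofReal_le_ofReal (Real.exp_le_exp.2 ?_)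
    · intro p hp
      have := passesTest_of_modifiedDecoder_eq hp k hk
      rw [← Finset.sum_div, div_le_iff₀ hσ] at this
      exact this
    · ext p
      refine Iff.of_eq ?_
      change (∑ i ∈ L, (((c i + p.1 i) + p.2.1 i + Z (c + p.1 + p.2.2) a i) - t b i - H.x b i) ^ 2
        ≤ T) = (∑ i ∈ L, (p.1 i + p.2.1 i +
          (c i + Z (c + (p.1 + p.2.2)) a i - t b i - H.x b i)) ^ 2 ≤ T)
      congr 1
      refine Finset.sum_congr rfl fun i _ => ?_
      rw [add_assoc c p.1 p.2.2]
      ring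
    · have hsum : ∑ i ∈ L, (-(lam / (2 * τd) * τ i) + (lam / (2 * τd) * τ i) ^ 2)
          = ((L.filter fun i => f a i = k).card : ℝ) *
              (-(lam / (2 * τd) * τk) + (lam / (2 * τd) * τk) ^ 2)
            + (ℓ - (L.filter fun i => f a i = k).card) *
              (-(lam / (2 * τd) * τd) + (lam / (2 * τd) * τd) ^ 2) := by
        rw [← Finset.sum_filter_add_sum_filter_not L (fun i => f a i = k)]
        have hadd := Finset.card_filter_add_card_filter_not (s := L) (fun i => f a i = k)
        have hadd' : (ℓ - (L.filter fun i => f a i = k).card : ℝ)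
            = (L.filter fun i => ¬ f a i = k).card := by
          rw [← hcard, ← hadd]; push_cast; ring
        rw [hadd']
        congr 1
        · rw [Finset.sum_congr rfl (g := fun _ => -(lam / (2 * τd) * τk)
            + (lam / (2 * τd) * τk) ^ 2) fun i hi => by
              simp only [hτ, (Finset.mem_filter.1 hi).2, if_true]]
          rw [Finset.sum_const, nsmul_eq_mul]
        · rw [Finset.sum_congr rfl (g := fun _ => -(lam / (2 * τd) * τd)
            + (lam / (2 * τd) * τd) ^ 2) fun i hi => by
              simp only [hτ, (Finset.mem_filter.1 hi).2, if_false]]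
          rw [Finset.sum_const, nsmul_eq_mul]
      rw [hsum]
      refine detection_exponent_le (by positivity) ?_ hγ1 (by linarith) hg hl1 hτk0 hτkd ?_
      · refine le_trans (le_of_eq ?_) hkA
        congr 2
        ext i
        simp [hL, levelSet]
      · have := mul_le_mul_of_nonneg_left hthr (show 0 ≤ ℓ by positivity)
        rw [hT]
        linarith
  exact ENNReal.toReal_le_of_le_ofReal (Real.exp_pos _).le hle

/-- For a positive gap the first exponential suffices and the second is slack; for gap zero the
right side is 2 and nothing is claimed. -/
theorem targetedFalseAuth_modifiedCode_le (H : DetCode M n) {ρΔ ρDec ρAdv δ γ r : ℝ}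
    (hρΔ : 0 < ρΔ) (hρDec : 0 < ρDec) (hρAdv : 0 < ρAdv) (hδ : 0 < δ) {K : Finset ℝ}
    {f : M → Fin n → ℝ} (hf : IsOverlayCode r K γ f) (t : M → Fin n → ℝ) :
    (modifiedCode H f K ρΔ ρDec δ t).targetedFalseAuth ρDec ρAdv ≤
      Real.exp (-(1 / 8 * (levelSize n K : ℝ) * (1 - γ)
          * detectionGap K γ ρΔ ρDec ρAdv δ ^ 2))
        + Real.exp (-(1 / 8 * (levelSize n K : ℝ) * γ
          * detectionGap K γ ρΔ ρDec ρAdv δ ^ 2)) := by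
  refine Real.sSup_le ?_ (by positivity)
  rintro p ⟨Z, hZ, a, b, hba, rfl⟩
  rcases (detectionGap_nonneg K γ ρΔ ρDec ρAdv δ).eq_or_lt with h0 | hpos
  · rw [← h0]
    have := (modifiedCode H f K ρΔ ρDec δ t).isProbabilityMeasure_encoder a
    have h1 : (modifiedCode H f K ρΔ ρDec δ t).targetedProb ρDec ρAdv Z a b ≤ 1 :=
      measureReal_le_one
    refine h1.trans ?_
    norm_num
  · exact (targetedProb_modifiedCode_le H hρΔ hρDec hρAdv hδ hf t hZ hba hpos).trans
      (le_add_of_nonneg_right (Real.exp_pos _).le)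

end Modified

/-! ### Error probability -/

section ErrorProbability

variable {M : Type*} {n : ℕ}

/-- The error probability of the decoder of `H` when the codeword of `m`, shifted by `τ`, is
observed in independent Gaussian noise of variances `w`. -/
noncomputable def shiftedError (H : DetCode M n) (w : Fin n → ℝ) (m : M) (τ : Fin n → ℝ) : ℝ :=
  (gaussianVec w).real {N | H.dec (H.x m + τ + N) ≠ m}

theorem measurableSet_dec_ne (H : DetCode M n) (m : M) : MeasurableSet {y | H.dec y ≠ m} :=
  (H.measurableSet_dec m).compl

theorem measurable_shiftedError (H : DetCode M n) (w : Fin n → ℝ) (m : M) :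
    Measurable (shiftedError H w m) := by
  have hS : MeasurableSet {p : (Fin n → ℝ) × (Fin n → ℝ) | H.dec (H.x m + p.1 + p.2) ≠ m} :=
    (measurableSet_dec_ne H m).preimage (by fun_prop)
  exact (measurable_measure_prodMk_left (ν := gaussianVec w) hS).ennreal_toReal

/-- By Fubini, averaging over a Gaussian shift convolves it with the noise, and variances add. -/
theorem integral_shiftedError (H : DetCode M n) {v w : Fin n → ℝ} (hv : ∀ i, 0 ≤ v i)
    (hw : ∀ i, 0 ≤ w i) (m : M) :
    ∫ τ, shiftedError H w m τ ∂gaussianVec v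
      = (gaussianVec (v + w)).real {N | H.dec (H.x m + N) ≠ m} := by
  have hS : MeasurableSet {p : (Fin n → ℝ) × (Fin n → ℝ) | H.dec (H.x m + p.1 + p.2) ≠ m} :=
    (measurableSet_dec_ne H m).preimage (by fun_prop)
  have hB : MeasurableSet {N : Fin n → ℝ | H.dec (H.x m + N) ≠ m} :=
    (measurableSet_dec_ne H m).preimage (by fun_prop)
  unfold shiftedError Measure.real
  have hint := integral_toReal (μ := gaussianVec v)
    (measurable_measure_prodMk_left (ν := gaussianVec w) hS).aemeasurable
    (Filter.Eventually.of_forall fun τ => measure_lt_top _ _)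
  refine hint.trans ?_
  rw [← (measurePreserving_add_gaussianVec hv hw).measure_preimage hB.nullMeasurableSet]
  have hset : (fun p : (Fin n → ℝ) × (Fin n → ℝ) => p.1 + p.2) ⁻¹'
      {N | H.dec (H.x m + N) ≠ m} = {p | H.dec (H.x m + p.1 + p.2) ≠ m} := by
    ext p
    simp only [Set.mem_preimage, Set.mem_ofPred_eq, add_assoc]
  rw [hset, Measure.prod_apply hS]

variable [Fintype M]

theorem errorProb_toCode (H : DetCode M n) (ρ : ℝ) :
    H.toCode.errorProb ρ = ∑ m : M, 1 / (Fintype.card M : ℝ) *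
      (gaussianIID n ρ).real {N | H.dec (H.x m + N) ≠ m} := by
  unfold Code.errorProb
  refine Finset.sum_congr rfl fun m _ => ?_
  congr 1
  have hS : MeasurableSet {p : (Fin n → ℝ) × (Fin n → ℝ) | H.dec (p.1 + p.2) ≠ m} :=
    (measurableSet_dec_ne H m).preimage (by fun_prop)
  have hset : {p : (Fin n → ℝ) × (Fin n → ℝ) | H.toCode.decoder (p.1 + p.2) ≠ some m}
      = {p | H.dec (p.1 + p.2) ≠ m} := by
    ext p
    simp [DetCode.toCode]
  rw [hset]
  change ((Measure.dirac (H.x m)).prod _).real _ = _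
  unfold Measure.real
  rw [Measure.dirac_prod, Measure.map_apply (by fun_prop) hS]
  rfl

/-- The law of the observation of the modified codeword in Gaussian noise. -/
theorem encoder_prod_noise_apply (H : DetCode M n) (f : M → Fin n → ℝ) (K : Finset ℝ)
    {ρΔ ρDec : ℝ} (hρΔ : 0 ≤ ρΔ) (hρDec : 0 ≤ ρDec) (δ : ℝ) (t : M → Fin n → ℝ) (m : M)
    {B : Set (Fin n → ℝ)} (hB : MeasurableSet B) :
    (((modifiedCode H f K ρΔ ρDec δ t).encoder m).prod (gaussianIID n ρDec)) {p | p.1 + p.2 ∈ B}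
      = gaussianVec (fun i => f m i ^ 2 * ρΔ + ρDec) {N | H.x m + t m + N ∈ B} := by
  have m1 := (measurePreserving_encoder H f K ρΔ ρDec δ t m).prod
    (MeasurePreserving.id (gaussianIID n ρDec))
  have m2 := measurePreserving_add_gaussianVec (v := fun i => f m i ^ 2 * ρΔ)
    (w := fun _ => ρDec) (fun i => by positivity) fun _ => hρDec
  have hS : MeasurableSet {p : (Fin n → ℝ) × (Fin n → ℝ) | p.1 + p.2 ∈ B} :=
    hB.preimage (by fun_prop)
  have hS' : MeasurableSet {N : Fin n → ℝ | H.x m + t m + N ∈ B} :=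
    hB.preimage (by fun_prop)
  rw [← m1.measure_preimage hS.nullMeasurableSet]
  refine Eq.trans ?_ (m2.measure_preimage hS'.nullMeasurableSet)
  congr 1
  ext p
  simp [add_assoc]

/-- Union bound over the levels. On level `k` the noise has constant variance `σ = k² ρΔ + ρDec`,
and the tilt `δ / (4σ)` gives `δ/4 + δ²/8 - δ(1 + δ)/4 = -δ²/8` per coordinate. -/
theorem passesTest_failure_le {r : ℝ} (H : DetCode M n) {f : M → Fin n → ℝ} {K : Finset ℝ}
    {ρΔ ρDec δ γ : ℝ} (hρΔ : 0 ≤ ρΔ) (hρDec : 0 < ρDec) (hδ : 0 < δ) (hδ1 : δ ≤ 1)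
    (hf : IsOverlayCode r K γ f) (t : M → Fin n → ℝ) (m : M) :
    gaussianVec (fun i => f m i ^ 2 * ρΔ + ρDec)
        {N | ¬ passesTest H.x f t K ρΔ ρDec δ (H.x m + t m + N) m}
      ≤ ENNReal.ofReal (K.card * Real.exp (-(1 / 8 * (levelSize n K : ℝ) * δ ^ 2))) := by
  have hsub : {N | ¬ passesTest H.x f t K ρΔ ρDec δ (H.x m + t m + N) m} ⊆
      ⋃ k ∈ K, {N : Fin n → ℝ | (levelSize n K * (1 + δ)) * (k ^ 2 * ρΔ + ρDec)
        ≤ ∑ i ∈ levelSet (f m) k, N i ^ 2} := by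
    intro N hN
    simp only [passesTest, not_forall, not_le, Set.mem_ofPred_eq] at hN
    obtain ⟨k, hk, hlt⟩ := hN
    refine Set.mem_biUnion hk ?_
    have hσ : 0 < k ^ 2 * ρΔ + ρDec := by positivity
    rw [← Finset.sum_div, lt_div_iff₀ hσ] at hlt
    refine hlt.le.trans (le_of_eq (Finset.sum_congr rfl fun i _ => ?_))
    simp only [Pi.add_apply]
    ring
  have hk : ∀ k ∈ K, gaussianVec (fun i => f m i ^ 2 * ρΔ + ρDec)
      {N : Fin n → ℝ | (levelSize n K * (1 + δ)) * (k ^ 2 * ρΔ + ρDec)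
        ≤ ∑ i ∈ levelSet (f m) k, N i ^ 2}
      ≤ ENNReal.ofReal (Real.exp (-(1 / 8 * (levelSize n K : ℝ) * δ ^ 2))) := by
    intro k hk
    have hσ : 0 < k ^ 2 * ρΔ + ρDec := by positivity
    have hval : ∀ i ∈ levelSet (f m) k, f m i = k := fun i hi => (Finset.mem_filter.1 hi).2
    have hmul : δ / (4 * (k ^ 2 * ρΔ + ρDec)) * (k ^ 2 * ρΔ + ρDec) = δ / 4 := by field_simp
    refine (gaussianVec_sum_sq_ge_le (v := fun i => f m i ^ 2 * ρΔ + ρDec)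
      (fun i => by positivity) (levelSet (f m) k) (s := δ / (4 * (k ^ 2 * ρΔ + ρDec)))
      (by positivity) (fun i hi => ?_) _).trans
      (ENNReal.ofReal_le_ofReal (Real.exp_le_exp.2 (le_of_eq ?_)))
    · rw [hval i hi, mul_assoc, hmul]
      linarith
    · rw [Finset.sum_congr rfl (g := fun _ => δ / 4 + 2 * (δ / 4) ^ 2) fun i hi => by
        simp only [hval i hi, hmul], Finset.sum_const, hf.card_level m k hk, nsmul_eq_mul,
        mul_comm (_ * _) (k ^ 2 * ρΔ + ρDec), ← mul_assoc, hmul]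
      ring
  refine (measure_mono hsub).trans ((measure_biUnion_finset_le K _).trans ?_)
  refine (Finset.sum_le_sum hk).trans (le_of_eq ?_)
  rw [Finset.sum_const, nsmul_eq_mul, ENNReal.ofReal_mul (by positivity), ENNReal.ofReal_natCast]

/-- An error requires that the decoder of `H` is wrong or that the true message fails its own test.
-/
theorem errorProb_modifiedCode_le {r : ℝ} [Nonempty M] (H : DetCode M n) {f : M → Fin n → ℝ}
    {K : Finset ℝ} {ρΔ ρDec δ γ : ℝ} (hρΔ : 0 ≤ ρΔ) (hρDec : 0 < ρDec) (hδ : 0 < δ) (hδ1 : δ ≤ 1)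
    (hf : IsOverlayCode r K γ f) (t : M → Fin n → ℝ) :
    (modifiedCode H f K ρΔ ρDec δ t).errorProb ρDec ≤
      ∑ m : M, 1 / (Fintype.card M : ℝ) *
        shiftedError H (fun i => f m i ^ 2 * ρΔ + ρDec) m (t m)
      + K.card * Real.exp (-(1 / 8 * (levelSize n K : ℝ) * δ ^ 2)) := by
  set E := (K.card : ℝ) * Real.exp (-(1 / 8 * (levelSize n K : ℝ) * δ ^ 2)) with hE
  have hE0 : 0 ≤ E := by positivity
  have hM : (0 : ℝ) < Fintype.card M := by exact_mod_cast Fintype.card_pos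
  have hm : ∀ m : M, (((modifiedCode H f K ρΔ ρDec δ t).encoder m).prod (gaussianIID n ρDec)).real
      {p | (modifiedCode H f K ρΔ ρDec δ t).decoder (p.1 + p.2) ≠ some m}
      ≤ shiftedError H (fun i => f m i ^ 2 * ρΔ + ρDec) m (t m) + E := by
    intro m
    have := (modifiedCode H f K ρΔ ρDec δ t).isProbabilityMeasure_encoder m
    have hsub : {p : (Fin n → ℝ) × (Fin n → ℝ) |
        (modifiedCode H f K ρΔ ρDec δ t).decoder (p.1 + p.2) ≠ some m}
        ⊆ {p | p.1 + p.2 ∈ {y | H.dec y ≠ m}} ∪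
          {p | p.1 + p.2 ∈ {y | ¬ passesTest H.x f t K ρΔ ρDec δ y m}} := by
      intro p hp
      by_contra hc
      simp only [Set.mem_union, Set.mem_ofPred_eq, not_or, not_not] at hc
      apply hp
      change modifiedDecoder H f t K ρΔ ρDec δ (p.1 + p.2) = some m
      unfold modifiedDecoder
      rw [hc.1, if_pos hc.2]
    refine (measureReal_mono hsub).trans ((measureReal_union_le _ _).trans ?_)
    refine add_le_add (le_of_eq ?_) ?_
    · unfold shiftedError Measure.real
      rw [encoder_prod_noise_apply H f K hρΔ hρDec.le δ t m (measurableSet_dec_ne H m)]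
      rfl
    · refine ENNReal.toReal_le_of_le_ofReal hE0 ?_
      refine (encoder_prod_noise_apply H f K hρΔ hρDec.le δ t m
        (measurableSet_passesTest H.x f t K ρΔ ρDec δ m).compl).trans_le ?_
      exact passesTest_failure_le H hρΔ hρDec hδ hδ1 hf t m
  calc (modifiedCode H f K ρΔ ρDec δ t).errorProb ρDec
      ≤ ∑ m : M, 1 / (Fintype.card M : ℝ) *
        (shiftedError H (fun i => f m i ^ 2 * ρΔ + ρDec) m (t m) + E) :=
        Finset.sum_le_sum fun m _ => mul_le_mul_of_nonneg_left (hm m) (by positivity)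
    _ = _ := by
      simp_rw [mul_add, Finset.sum_add_distrib]
      rw [Finset.sum_const, Finset.card_univ, nsmul_eq_mul]
      congr 1
      field_simp

theorem IsOverlayCode.value_sq_le_one {r : ℝ} {K : Finset ℝ} {γ : ℝ} {f : M → Fin n → ℝ}
    (hf : IsOverlayCode r K γ f) (m : M) (i : Fin n) : f m i ^ 2 ≤ 1 := by
  rcases Finset.mem_insert.1 (hf.value_mem m i) with h | h
  · rw [h]; norm_num
  · obtain ⟨h0, h1⟩ := hf.level_mem _ h
    nlinarith

/-- Hoeffding bound for the random choice of the shifts. -/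
theorem shiftLaw_errorProb_le {r : ℝ} [Nonempty M] (H : DetCode M n) {f : M → Fin n → ℝ}
    {K : Finset ℝ} {ρΔ ρDec γ : ℝ} (hρΔ : 0 ≤ ρΔ) (hρDec : 0 ≤ ρDec)
    (hf : IsOverlayCode r K γ f) {η : ℝ} (hη : 0 ≤ η) :
    (shiftLaw f ρΔ).real {t | H.toCode.errorProb (ρDec + ρΔ) + η ≤ ∑ m : M,
        1 / (Fintype.card M : ℝ) * shiftedError H (fun i => f m i ^ 2 * ρΔ + ρDec) m (t m)}
      ≤ Real.exp (-(2 * (Fintype.card M : ℝ) * η ^ 2)) := by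
  have hM : (0 : ℝ) < Fintype.card M := by exact_mod_cast Fintype.card_pos
  have hv : ∀ m i, 0 ≤ (1 - f m i ^ 2) * ρΔ := fun m i =>
    mul_nonneg (sub_nonneg.2 (hf.value_sq_le_one m i)) hρΔ
  set Q : M → (Fin n → ℝ) → ℝ := fun m => shiftedError H (fun i => f m i ^ 2 * ρΔ + ρDec) m
    with hQ
  have hQm : ∀ m, Measurable (Q m) := fun m => measurable_shiftedError H _ m
  have hmean : ∀ m, ∫ t, Q m (t m) ∂shiftLaw f ρΔ
      = (gaussianIID n (ρDec + ρΔ)).real {N | H.dec (H.x m + N) ≠ m} := by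
    intro m
    -- The variances `(1 - f²) ρΔ` and `f² ρΔ + ρDec` add up to `ρDec + ρΔ` at every coordinate,
    -- whatever `f` is.
    have h1 := integral_shiftedError H (v := fun i => (1 - f m i ^ 2) * ρΔ)
      (w := fun i => f m i ^ 2 * ρΔ + ρDec) (hv m) (fun i => by positivity) m
    have h2 : ((fun i => (1 - f m i ^ 2) * ρΔ) + fun i => f m i ^ 2 * ρΔ + ρDec)
        = fun _ : Fin n => ρDec + ρΔ := by
      funext i; simp only [Pi.add_apply]; ring
    rw [h2] at h1
    have hmp := measurePreserving_eval (fun m => gaussianVec fun i => (1 - f m i ^ 2) * ρΔ) m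
    refine Eq.trans ?_ h1
    unfold shiftLaw
    rw [← hmp.map_eq, integral_map hmp.measurable.aemeasurable
      (hQm m).aestronglyMeasurable]
  have : IsProbabilityMeasure (shiftLaw f ρΔ) := by unfold shiftLaw; infer_instance
  have hind : iIndepFun (fun m t => Q m (t m) - ∫ t, Q m (t m) ∂shiftLaw f ρΔ) (shiftLaw f ρΔ) :=
    iIndepFun_pi (X := fun m τ => Q m τ - ∫ t, Q m (t m) ∂shiftLaw f ρΔ)
      fun m => ((hQm m).sub_const _).aemeasurable
  -- Hoeffding's lemma for values in `[0, 1]`: variance proxy 1/4, whence the factor 2 in the final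
  -- exponent.
  have hsub : ∀ m ∈ (Finset.univ : Finset M), HasSubgaussianMGF
      (fun t => Q m (t m) - ∫ t, Q m (t m) ∂shiftLaw f ρΔ) ((‖(1 : ℝ) - 0‖₊ / 2) ^ 2)
      (shiftLaw f ρΔ) := fun m _ =>
    hasSubgaussianMGF_of_mem_Icc ((hQm m).comp (measurable_pi_apply m)).aemeasurable
      (Filter.Eventually.of_forall fun t => ⟨measureReal_nonneg, measureReal_le_one⟩)
  have hH := HasSubgaussianMGF.measure_sum_ge_le_of_iIndepFun hind hsub
    (ε := Fintype.card M * η) (by positivity)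
  have hset : {t : M → Fin n → ℝ | H.toCode.errorProb (ρDec + ρΔ) + η ≤ ∑ m : M,
        1 / (Fintype.card M : ℝ) * shiftedError H (fun i => f m i ^ 2 * ρΔ + ρDec) m (t m)}
      = {t | Fintype.card M * η ≤ ∑ m : M, (Q m (t m) - ∫ t, Q m (t m) ∂shiftLaw f ρΔ)} := by
    ext t
    simp only [Set.mem_ofPred_eq, hmean, errorProb_toCode, Finset.sum_sub_distrib,
      ← Finset.mul_sum]
    rw [← mul_le_mul_iff_right₀ hM, mul_add, ← mul_assoc, ← mul_assoc, mul_one_div_cancel hM.ne',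
      one_mul, one_mul, ← le_sub_iff_add_le']
  rw [hset]
  refine hH.trans (Real.exp_le_exp.2 (le_of_eq ?_))
  rw [Finset.sum_const, Finset.card_univ]
  simp only [sub_zero, nnnorm_one, nsmul_eq_mul]
  push_cast
  field_simp

end ErrorProbability

/-! ### Power -/

section Power

theorem sum_inv_mul_ofReal {n : ℕ} (hn : 0 < n) {a : Fin n → ℝ} (ha : ∀ i, 0 ≤ a i) :
    ∑ i, (n : ℝ≥0∞)⁻¹ * ENNReal.ofReal (a i) = ENNReal.ofReal (1 / n * ∑ i, a i) := by
  rw [← Finset.mul_sum, ← ENNReal.ofReal_sum_of_nonneg fun i _ => ha i,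
    ENNReal.ofReal_mul (by positivity), one_div, ENNReal.ofReal_inv_of_pos (by exact_mod_cast hn),
    ENNReal.ofReal_natCast]

variable {M : Type*} {n : ℕ}

theorem power_toCode (H : DetCode M n) (hn : 0 < n) :
    H.toCode.power = ⨆ m : M, ENNReal.ofReal (1 / n * ∑ i, H.x m i ^ 2) := by
  unfold Code.power
  congr 1
  funext m
  rw [← sum_inv_mul_ofReal hn fun i => sq_nonneg _]
  refine Finset.sum_congr rfl fun i _ => ?_
  congr 1
  exact lintegral_dirac' (H.x m) (by fun_prop)

variable [Fintype M]

theorem sum_sq_le_power (H : DetCode M n) (hn : 0 < n) (m : M) :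
    ∑ i, H.x m i ^ 2 ≤ n * H.toCode.power.toReal := by
  have hn' : (0 : ℝ) < n := by exact_mod_cast hn
  -- Finitely many deterministic codewords have finite power, so `toReal` loses nothing.
  have htop : H.toCode.power ≠ ⊤ := by
    rw [power_toCode H hn]
    exact ((iSup_le fun m => Finset.single_le_sum
      (f := fun m => ENNReal.ofReal (1 / n * ∑ i, H.x m i ^ 2)) (fun _ _ => zero_le)
      (Finset.mem_univ m)).trans_lt (ENNReal.sum_lt_top.2 fun _ _ => ENNReal.ofReal_lt_top)).ne
  have h : ENNReal.ofReal (1 / n * ∑ i, H.x m i ^ 2) ≤ H.toCode.power := by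
    rw [power_toCode H hn]
    exact le_iSup (fun m => ENNReal.ofReal (1 / n * ∑ i, H.x m i ^ 2)) m
  have h' := (ENNReal.ofReal_le_iff_le_toReal htop).1 h
  rw [one_div, ← div_eq_inv_mul, div_le_iff₀ hn'] at h'
  linarith

theorem lintegral_sq_encoder (H : DetCode M n) (f : M → Fin n → ℝ) (K : Finset ℝ) {ρΔ : ℝ}
    (hρΔ : 0 ≤ ρΔ) (ρDec δ : ℝ) (t : M → Fin n → ℝ) (m : M) (i : Fin n) :
    ∫⁻ x, ENNReal.ofReal (x i ^ 2) ∂((modifiedCode H f K ρΔ ρDec δ t).encoder m)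
      = ENNReal.ofReal ((H.x m i + t m i) ^ 2 + f m i ^ 2 * ρΔ) := by
  change ∫⁻ x, ENNReal.ofReal (x i ^ 2)
    ∂((gaussianIID n ρΔ).map fun g => H.x m + t m + f m * g) = _
  rw [lintegral_map (by fun_prop) (by fun_prop)]
  have hmp := measurePreserving_eval (fun _ : Fin n => gaussianReal 0 ρΔ.toNNReal) i
  have h := hmp.lintegral_comp
    (f := fun y => ENNReal.ofReal ((H.x m i + t m i + f m i * y) ^ 2)) (by fun_prop)
  rw [lintegral_sq_add_mul_gaussianReal, Real.coe_toNNReal _ hρΔ] at h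
  exact h

/-- The energy of `t m` is measured from its mean `ρΔ ∑ (1 - f²)`, which together with the
artificial noise `ρΔ ∑ f²` makes exactly `n ρΔ`. -/
theorem power_modifiedCode_le (H : DetCode M n) (hn : 0 < n) (f : M → Fin n → ℝ) (K : Finset ℝ)
    {ρΔ : ℝ} (hρΔ : 0 ≤ ρΔ) (ρDec δ : ℝ) {t : M → Fin n → ℝ} {A B : ℝ}
    (hlin : ∀ m, ∑ i, H.x m i * t m i ≤ n * A)
    (hsq : ∀ m, ∑ i, t m i ^ 2 ≤ ρΔ * (∑ i, (1 - f m i ^ 2) + n * B)) :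
    (modifiedCode H f K ρΔ ρDec δ t).power
      ≤ ENNReal.ofReal (H.toCode.power.toReal + 2 * A + ρΔ * (1 + B)) := by
  have hn' : (0 : ℝ) < n := by exact_mod_cast hn
  refine iSup_le fun m => ?_
  simp_rw [lintegral_sq_encoder H f K hρΔ ρDec δ t m]
  rw [sum_inv_mul_ofReal hn fun i => by positivity]
  refine ENNReal.ofReal_le_ofReal ?_
  rw [one_div, ← div_eq_inv_mul, div_le_iff₀ hn']
  have e : ∑ i, ((H.x m i + t m i) ^ 2 + f m i ^ 2 * ρΔ)
      = ∑ i, H.x m i ^ 2 + 2 * ∑ i, H.x m i * t m i + ∑ i, t m i ^ 2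
        + ρΔ * (n - ∑ i, (1 - f m i ^ 2)) := by
    have : (n : ℝ) - ∑ i, (1 - f m i ^ 2) = ∑ i, f m i ^ 2 := by
      rw [Finset.sum_sub_distrib]; simp
    rw [this, Finset.mul_sum, Finset.mul_sum, ← Finset.sum_add_distrib, ← Finset.sum_add_distrib,
      ← Finset.sum_add_distrib]
    exact Finset.sum_congr rfl fun i _ => by ring
  rw [e]
  have h1 := sum_sq_le_power H hn m
  have h2 := hlin m
  have h3 := hsq m
  linarith

theorem shiftLaw_exists_le {f : M → Fin n → ℝ} {ρΔ c : ℝ} (hc : 0 ≤ c)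
    {A : M → Set (Fin n → ℝ)} (hA : ∀ m, MeasurableSet (A m))
    (h : ∀ m, gaussianVec (fun i => (1 - f m i ^ 2) * ρΔ) (A m) ≤ ENNReal.ofReal c) :
    (shiftLaw f ρΔ).real {t | ∃ m, t m ∈ A m} ≤ Fintype.card M * c := by
  refine ENNReal.toReal_le_of_le_ofReal (by positivity) ?_
  have hset : {t : M → Fin n → ℝ | ∃ m, t m ∈ A m} = ⋃ m, Function.eval m ⁻¹' A m := by
    ext t; simp
  rw [hset]
  calc shiftLaw f ρΔ (⋃ m, Function.eval m ⁻¹' A m)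
      ≤ ∑ m, shiftLaw f ρΔ (Function.eval m ⁻¹' A m) := measure_iUnion_fintype_le _ _
    _ ≤ ∑ _m : M, ENNReal.ofReal c := Finset.sum_le_sum fun m _ => by
        refine le_trans (le_of_eq ?_) (h m)
        exact (measurePreserving_eval (fun m => gaussianVec fun i => (1 - f m i ^ 2) * ρΔ)
          m).measure_preimage (hA m).nullMeasurableSet
    _ = ENNReal.ofReal (Fintype.card M * c) := by
        rw [Finset.sum_const, nsmul_eq_mul, Finset.card_univ, ENNReal.ofReal_mul (by positivity),
          ENNReal.ofReal_natCast]

/-- The sum is a centred Gaussian of variance at most `V`; the Chernoff bound at `T = √(2Vc)` with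
tilt `T / V` gives `e^{-c}`. -/
theorem gaussianVec_correlation_gt_le (x : Fin n → ℝ) {v : Fin n → ℝ} {V c : ℝ}
    (hv : ∀ i, 0 ≤ v i) (hV : ∑ i, x i ^ 2 * v i ≤ V) (hV0 : 0 ≤ V) (hx : V = 0 → x = 0)
    (hc : 0 < c) :
    gaussianVec v {τ | √(2 * V * c) < ∑ i, x i * τ i} ≤ ENNReal.ofReal (Real.exp (-c)) := by
  rcases hV0.eq_or_lt with h0 | hpos
  -- For `V = 0` both sides of the strict inequality vanish, so the event is empty; a non-strict one
  -- would be certain.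
  · have : {τ : Fin n → ℝ | √(2 * V * c) < ∑ i, x i * τ i} = ∅ := by
      ext τ
      simp [hx h0.symm, ← h0]
    rw [this, measure_empty]
    exact zero_le
  · set T := √(2 * V * c) with hT
    have hT0 : 0 < T := Real.sqrt_pos.2 (by positivity)
    have hT2 : T ^ 2 = 2 * V * c := Real.sq_sqrt (by positivity)
    refine (measure_mono (t := {τ : Fin n → ℝ | T ≤ ∑ i, x i * τ i})
      fun τ (hτ : T < _) => hτ.le).trans
      ((gaussianVec_sum_mul_ge_le hv x (s := T / V) (by positivity) T).trans
        (ENNReal.ofReal_le_ofReal (Real.exp_le_exp.2 ?_)))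
    have e : ∑ i, v i * (T / V * x i) ^ 2 / 2 = (T / V) ^ 2 / 2 * ∑ i, x i ^ 2 * v i := by
      rw [Finset.mul_sum]
      exact Finset.sum_congr rfl fun i _ => by ring
    rw [e]
    have h1 : (T / V) ^ 2 / 2 * ∑ i, x i ^ 2 * v i ≤ (T / V) ^ 2 / 2 * V := by gcongr
    have h2 : (T / V) ^ 2 / 2 * V - T / V * T = -c := by
      have : (T / V) ^ 2 / 2 * V - T / V * T = -(T ^ 2 / (2 * V)) := by field_simp; ring
      rw [this, hT2]
      field_simp
    linarith

/-- All variances are at most `ρ`, so `1 / (4ρ)` is an admissible tilt. The linear terms cancel the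
mean, and each quadratic term is at most 1/8. -/
theorem gaussianVec_energy_ge_le {u : Fin n → ℝ} (hu : ∀ i, u i ^ 2 ≤ 1) {ρ B : ℝ} (hρ : 0 < ρ) :
    gaussianVec (fun i => (1 - u i ^ 2) * ρ) {τ | ρ * (∑ i, (1 - u i ^ 2) + B) ≤ ∑ i, τ i ^ 2}
      ≤ ENNReal.ofReal (Real.exp (n / 8 - B / 4)) := by
  have hmul : ∀ a : ℝ, 1 / (4 * ρ) * (a * ρ) = a / 4 := fun a => by field_simp
  refine (gaussianVec_sum_sq_ge_le (v := fun i => (1 - u i ^ 2) * ρ)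
    (fun i => mul_nonneg (sub_nonneg.2 (hu i)) hρ.le) Finset.univ (s := 1 / (4 * ρ))
    (by positivity) (fun i _ => ?_) _).trans
    (ENNReal.ofReal_le_ofReal (Real.exp_le_exp.2 ?_))
  · rw [mul_assoc, hmul]
    linarith [sq_nonneg (u i)]
  · rw [mul_comm ρ, hmul]
    have h : ∑ i, (1 / (4 * ρ) * ((1 - u i ^ 2) * ρ) + 2 * (1 / (4 * ρ) * ((1 - u i ^ 2) * ρ)) ^ 2)
        ≤ ∑ i, ((1 - u i ^ 2) / 4 + 1 / 8) := by
      refine Finset.sum_le_sum fun i _ => ?_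
      rw [hmul]
      have h0 : 0 ≤ 1 - u i ^ 2 := sub_nonneg.2 (hu i)
      have h1 : 1 - u i ^ 2 ≤ 1 := by linarith [sq_nonneg (u i)]
      nlinarith
    rw [Finset.sum_add_distrib (g := fun _ => (1 / 8 : ℝ)), ← Finset.sum_div, Finset.sum_const,
      Finset.card_univ, Fintype.card_fin, nsmul_eq_mul] at h
    linarith

end Power

/-! ### Assembly -/

section Main

variable {M : Type*} [Fintype M] {n : ℕ}

/-- Since `1 / 0 = 0` and `log 0 = log 1 = 0`, a positive rate excludes `n = 0` and `|M| ≤ 1`;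
separating two messages then needs a level in `K`. -/
theorem IsOverlayCode.card_pos {r : ℝ} {K : Finset ℝ} {γ : ℝ} {f : M → Fin n → ℝ}
    (hf : IsOverlayCode r K γ f) : 0 < n ∧ 1 < Fintype.card M ∧ 0 < K.card := by
  have hpos := hf.rate_pos.trans_le hf.rate_le
  have hn : 0 < n := by
    rcases Nat.eq_zero_or_pos n with h | h
    · subst h; simp at hpos
    · exact h
  have hlog : 0 < Real.log (Fintype.card M) :=
    pos_of_mul_pos_right hpos (by positivity)
  have hcard : 1 < Fintype.card M := by
    by_contra hc
    have : Fintype.card M = 0 ∨ Fintype.card M = 1 := by omega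
    rcases this with h | h <;> rw [h] at hlog <;> simp at hlog
  obtain ⟨a, b, hab⟩ := Fintype.exists_pair_of_one_lt_card hcard
  obtain ⟨k, hk, -⟩ := hf.separated a b hab
  exact ⟨hn, hcard, Finset.card_pos.2 ⟨k, hk⟩⟩

theorem shiftLaw_correlation_le (H : DetCode M n) {f : M → Fin n → ℝ} {K : Finset ℝ} {r γ ρΔ : ℝ}
    (hn : 0 < n) (hρΔ : 0 < ρΔ) (hf : IsOverlayCode r K γ f) {q : ℝ} (hq : 0 < q) :
    (shiftLaw f ρΔ).real {t | ∃ m, t m ∈ {τ : Fin n → ℝ |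
        n * √(2 * H.toCode.power.toReal * ρΔ * q) < ∑ i, H.x m i * τ i}}
      ≤ Fintype.card M * Real.exp (-(n * q)) := by
  have hn' : (0 : ℝ) < n := by exact_mod_cast hn
  set ω := H.toCode.power.toReal with hω
  have hω0 : 0 ≤ ω := ENNReal.toReal_nonneg
  have hsqrt : n * √(2 * ω * ρΔ * q) = √(2 * (n * ω * ρΔ) * (n * q)) := by
    rw [show 2 * (n * ω * ρΔ) * (n * q) = (n : ℝ) ^ 2 * (2 * ω * ρΔ * q) by ring,
      Real.sqrt_mul (sq_nonneg _), Real.sqrt_sq hn'.le]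
  rw [hsqrt]
  refine shiftLaw_exists_le (Real.exp_pos _).le
    (fun m => measurableSet_lt measurable_const (by fun_prop)) fun m => ?_
  have hsq := sum_sq_le_power H hn m
  refine gaussianVec_correlation_gt_le (H.x m) (V := n * ω * ρΔ)
    (fun i => mul_nonneg (sub_nonneg.2 (hf.value_sq_le_one m i)) hρΔ.le) ?_ (by positivity)
    (fun h0 => ?_) (by positivity)
  · calc ∑ i, H.x m i ^ 2 * ((1 - f m i ^ 2) * ρΔ) ≤ ∑ i, H.x m i ^ 2 * ρΔ := by
          gcongr with i
          nlinarith [sq_nonneg (f m i)]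
      _ = (∑ i, H.x m i ^ 2) * ρΔ := by rw [Finset.sum_mul]
      _ ≤ n * ω * ρΔ := by gcongr
  · have h1 : n * ω = 0 := (mul_eq_zero.1 h0).resolve_right hρΔ.ne'
    rw [h1] at hsq
    have h2 : ∑ i, H.x m i ^ 2 = 0 := le_antisymm hsq (Finset.sum_nonneg fun i _ => sq_nonneg _)
    funext i
    have := (Finset.sum_eq_zero_iff_of_nonneg fun i _ => sq_nonneg _).1 h2 i (Finset.mem_univ i)
    simpa using this

theorem shiftLaw_energy_le {f : M → Fin n → ℝ} {K : Finset ℝ} {r γ ρΔ : ℝ}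
    (hρΔ : 0 < ρΔ) (hf : IsOverlayCode r K γ f) (B : ℝ) :
    (shiftLaw f ρΔ).real {t | ∃ m, t m ∈ {τ : Fin n → ℝ |
        ρΔ * (∑ i, (1 - f m i ^ 2) + B) ≤ ∑ i, τ i ^ 2}}
      ≤ Fintype.card M * Real.exp (n / 8 - B / 4) :=
  shiftLaw_exists_le (Real.exp_pos _).le
    (fun m => measurableSet_le measurable_const (by fun_prop))
    fun m => gaussianVec_energy_ge_le (hf.value_sq_le_one m) hρΔ

/-- The energy event has probability at most `e^{-7/8} e^{-n}`; this comparison provides the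
constant `√(2/π)` and the strict inequality of the theorem. -/
theorem exp_neg_lt_sqrt_two_div_pi : Real.exp (-(7 / 8)) < √(2 / Real.pi) := by
  have h1 : Real.exp (-(7 / 8)) < 1 / 2 := by
    rw [← Real.lt_log_iff_exp_lt (by norm_num), one_div, Real.log_inv]
    linarith [Real.log_two_lt_d9]
  have h2 : 1 / 2 ≤ √(2 / Real.pi) := by
    refine Real.le_sqrt_of_sq_le ?_
    rw [le_div_iff₀ Real.pi_pos]
    linarith [Real.pi_le_four]
  exact h1.trans_le h2

end Main

/-- With probability greater than `1 - (2 + √(2/π)) e^{-n}` over the choice of `t`, the modified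
code satisfies all four claims; stated as a bound on the probability of the complement. -/
theorem mainTheorem3 {M : Type*} [Fintype M] {n : ℕ} (H : DetCode M n)
    (ρΔ ρDec ρAdv δ γ : ℝ) (hρΔ : 0 < ρΔ) (hρDec : 0 < ρDec) (hρAdv : 0 < ρAdv)
    (hδ : 0 < δ ∧ δ < 1) (K : Finset ℝ) (f : M → Fin n → ℝ)
    (hf : IsOverlayCode H.toCode.rate K γ f) :
    (shiftLaw f ρΔ).real {t : M → Fin n → ℝ | ¬
      ((modifiedCode H f K ρΔ ρDec δ t).rate = H.toCode.rate ∧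
       (modifiedCode H f K ρΔ ρDec δ t).power ≤ ENNReal.ofReal
          (H.toCode.power.toReal
            + 2 * √(2 * H.toCode.power.toReal * ρΔ * (H.toCode.rate + 1))
            + ρΔ * (1 + 8 * ((tildeK K).card : ℝ) *
                (H.toCode.rate + 1 + Real.log (K.card : ℝ) / (n : ℝ)))) ∧
       (modifiedCode H f K ρΔ ρDec δ t).errorProb ρDec ≤
          H.toCode.errorProb (ρDec + ρΔ)
            + √((n : ℝ) / 2 * Real.exp (-((n : ℝ) * H.toCode.rate)))
            + (K.card : ℝ) * Real.exp (-(1 / 8 * (levelSize n K : ℝ) * δ ^ 2)) ∧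
       (modifiedCode H f K ρΔ ρDec δ t).targetedFalseAuth ρDec ρAdv ≤
          Real.exp (-(1 / 8 * (levelSize n K : ℝ) * (1 - γ)
              * detectionGap K γ ρΔ ρDec ρAdv δ ^ 2))
            + Real.exp (-(1 / 8 * (levelSize n K : ℝ) * γ
              * detectionGap K γ ρΔ ρDec ρAdv δ ^ 2)))}
      < (2 + √(2 / Real.pi)) * Real.exp (-(n : ℝ)) := by
  obtain ⟨hn, hM1, hK⟩ := hf.card_pos
  have hn' : (1 : ℝ) ≤ n := by exact_mod_cast hn
  have hn0 : (0 : ℝ) < n := by linarith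
  have hM : (0 : ℝ) < Fintype.card M := by exact_mod_cast hM1.le
  have : Nonempty M := Fintype.card_pos_iff.1 (by omega)
  have : IsProbabilityMeasure (shiftLaw f ρΔ) := by unfold shiftLaw; infer_instance
  have hr := hf.rate_pos
  set r := H.toCode.rate with hrdef
  set ω := H.toCode.power.toReal with hω
  have hcard : (Fintype.card M : ℝ) = Real.exp (n * r) := by
    rw [hrdef, Code.rate, ← mul_assoc, mul_one_div_cancel hn0.ne', one_mul, Real.exp_log hM]
  set q : ℝ := r + 1 + Real.log (K.card : ℝ) / n with hq
  have hqr : r + 1 ≤ q := by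
    have : 0 ≤ Real.log (K.card : ℝ) / n :=
      div_nonneg (Real.log_nonneg (by exact_mod_cast hK)) hn0.le
    linarith
  have hk : (1 : ℝ) ≤ (tildeK K).card := by
    exact_mod_cast Finset.card_pos.2 ⟨1, Finset.mem_insert_self 1 K⟩
  -- Chosen so that `2 |M| η² = n`, as `|M| = e^{nr}`.
  set η : ℝ := √((n : ℝ) / 2 * Real.exp (-((n : ℝ) * r))) with hη
  set B₁ : Set (M → Fin n → ℝ) := {t | H.toCode.errorProb (ρDec + ρΔ) + η ≤ ∑ m : M,
    1 / (Fintype.card M : ℝ) * shiftedError H (fun i => f m i ^ 2 * ρΔ + ρDec) m (t m)} with hB₁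
  set B₂ : Set (M → Fin n → ℝ) := {t | ∃ m, t m ∈ {τ : Fin n → ℝ |
    n * √(2 * ω * ρΔ * (r + 1)) < ∑ i, H.x m i * τ i}} with hB₂
  set B₃ : Set (M → Fin n → ℝ) := {t | ∃ m, t m ∈ {τ : Fin n → ℝ |
    ρΔ * (∑ i, (1 - f m i ^ 2) + n * (8 * ((tildeK K).card : ℝ) * q)) ≤ ∑ i, τ i ^ 2}} with hB₃
  have h₁ : (shiftLaw f ρΔ).real B₁ ≤ Real.exp (-(n : ℝ)) := by
    refine (shiftLaw_errorProb_le H hρΔ.le hρDec.le hf (Real.sqrt_nonneg _)).trans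
      (Real.exp_le_exp.2 (le_of_eq ?_))
    rw [Real.sq_sqrt (by positivity), hcard, Real.exp_neg]
    field_simp
  have h₂ : (shiftLaw f ρΔ).real B₂ ≤ Real.exp (-(n : ℝ)) := by
    refine (shiftLaw_correlation_le H hn hρΔ hf (by linarith)).trans (le_of_eq ?_)
    rw [hcard, ← Real.exp_add]
    congr 1
    ring
  have h₃ : (shiftLaw f ρΔ).real B₃ < √(2 / Real.pi) * Real.exp (-(n : ℝ)) := by
    refine (shiftLaw_energy_le hρΔ hf _).trans_lt ?_
    refine lt_of_le_of_lt ?_ (mul_lt_mul_of_pos_right exp_neg_lt_sqrt_two_div_pi (Real.exp_pos _))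
    rw [hcard, ← Real.exp_add, ← Real.exp_add]
    refine Real.exp_le_exp.2 ?_
    -- Only `|K ∪ {1}| ≥ 1` and `log |K| ≥ 0` are used: the exponent is at most `nr + n/8 - 2n(r +
    -- 1)`, which is at most `-7/8 - n` because `n ≥ 1`.
    have e1 : (r + 1) * 1 ≤ q * ((tildeK K).card : ℝ) :=
      mul_le_mul hqr hk zero_le_one (by linarith)
    have e2 := mul_le_mul_of_nonneg_left e1 hn0.le
    have e3 : 0 ≤ n * r := by positivity
    linarith
  -- The claims on rate and false authentication hold for every `t`, so only these three events can
  -- cause a failure.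
  refine (measureReal_mono (s₂ := (B₁ ∪ B₂) ∪ B₃) fun t ht => ?_).trans_lt ?_
  · by_contra hc
    simp only [Set.mem_union, not_or] at hc
    obtain ⟨⟨hc₁, hc₂⟩, hc₃⟩ := hc
    simp only [hB₁, hB₂, hB₃, Set.mem_ofPred_eq, not_exists, not_le, not_lt] at hc₁ hc₂ hc₃
    refine ht ⟨rfl, ?_, ?_, targetedFalseAuth_modifiedCode_le H hρΔ hρDec hρAdv hδ.1 hf t⟩
    · exact power_modifiedCode_le H hn f K hρΔ.le ρDec δ hc₂ fun m => (hc₃ m).le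
    · exact (errorProb_modifiedCode_le H hρΔ.le hρDec hδ.1 hδ.2.le hf t).trans
        (add_le_add_left hc₁.le _)
  · calc (shiftLaw f ρΔ).real ((B₁ ∪ B₂) ∪ B₃)
      ≤ (shiftLaw f ρΔ).real B₁ + (shiftLaw f ρΔ).real B₂ + (shiftLaw f ρΔ).real B₃ :=
        (measureReal_union_le _ _).trans (add_le_add_left (measureReal_union_le _ _) _)
    _ < _ := by linarith
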